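/- Let $q$ be a power of a prime $p$, let $X$ be a Noetherian scheme that is separated over the finite field $\mathbb{F}_q$ with $q$ elements, and let $F\colon X\to X$ be the $q$-power Frobenius, i.e. the identity on the underlying space and $r\mapsto r^q$ on sections of $\mathcal{O}_X$. Assume that $X$ is $F$-finite, i.e. that $F$ is a finite morphism. Let $(M,C)$ be a coherent Cartier module on $X$: a coherent $\mathcal{O}_X$-module $M$ with an additive map $C\colon M\to M$ of sheaves such that $C(r^q m)=r\,C(m)$ for all local sections $r$ of $\mathcal{O}_X$ and $m$ of $M$. A Cartier submodule of $M$ is a quasi-coherent $\mathcal{O}_X$-submodule $N\subseteq M$ with $C(N)\subseteq N$; then $C$ induces a Cartier module structure on $M/N$. For a Cartier module $(Q,C_Q)$ let $\mathrm{Supp}_{\mathrm{crys}}(Q)$ be the set of all $x\in X$ such that no power of the map induced by $C_Q$ on the stalk $Q_x$ is zero. Put $$\mathcal{S}=\{\mathrm{Supp}_{\mathrm{crys}}(M/N)\mid N\text{ a Cartier submodule of }M\}.$$ Then: 1. Every member of $\mathcal{S}$ is a reduced closed subscheme of $X$: for every Cartier submodule $N$ there is a quasi-coherent ideal sheaf $I$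 that equals $\mathrm{Ann}_{\mathcal{O}_X}(C^e(M/N))$ for all sufficiently large $e$, the closed subscheme $V(I)$ is reduced, and its underlying set is $\mathrm{Supp}_{\mathrm{crys}}(M/N)$. 2. The collection $\mathcal{S}$ is finite. 3. A subset of $X$ belongs to $\mathcal{S}$ if and only if it is the union of a finite (possibly empty) set of irreducible members of $\mathcal{S}$. -/

import Mathlib

universe u

open CategoryTheory AlgebraicGeometry Opposite TopologicalSpace

noncomputable section

namespace CartierCrystal

/-! ### The `q`-power Frobenius of a scheme over the field with `q` elements -/

section Frobenius

variable {K : Type u} [Field K] [Fintype K] {X : Scheme.{u}}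

/-- The ring homomorphism `K → Γ(X, U)` of a scheme over `Spec K`. -/
def structureMap (s : X ⟶ Spec (CommRingCat.of K)) (U : X.Opens) : K →+* Γ(X, U) :=
  ((Scheme.ΓSpecIso (CommRingCat.of K)).inv ≫ s.appTop ≫
    X.presheaf.map (homOfLE (le_top : U ≤ ⊤)).op).hom

/-- The ring homomorphism `r ↦ r ^ q` on `Γ(X, U)`, where `q = #K`. -/
def frobeniusApp (s : X ⟶ Spec (CommRingCat.of K)) (U : X.Opens) : Γ(X, U) →+* Γ(X, U) :=
  letI := (structureMap s U).toAlgebra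
  (FiniteField.frobeniusAlgHom K Γ(X, U)).toRingHom

/-- The Frobenius as a morphism of presheafed spaces: the identity on the space, and
`r ↦ r ^ q` on sections. -/
def frobeniusPresheafedSpace (s : X ⟶ Spec (CommRingCat.of K)) :
    X.toPresheafedSpace.Hom X.toPresheafedSpace where
  base := 𝟙 _
  c :=
    { app U := CommRingCat.ofHom (frobeniusApp s U.unop)
      naturality U V i := by
        ext r
        exact (map_pow (X.presheaf.map i).hom r _).symm }

/-- The `q`-power Frobenius `F : X ⟶ X` of a scheme `X` over the field `K` with `q` elements. -/
def frobenius (s : X ⟶ Spec (CommRingCat.of K)) : X ⟶ X where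
  toHom := frobeniusPresheafedSpace s
  prop x := by
    constructor
    intro a ha
    obtain ⟨U, hxU, t, rfl⟩ := X.presheaf.exists_germ_eq a
    have h := PresheafedSpace.stalkMap_germ_apply (frobeniusPresheafedSpace s) U x hxU t
    erw [h] at ha
    change IsUnit ((X.presheaf.germ U x hxU) (t ^ Fintype.card K)) at ha
    have h2 : (X.presheaf.germ U x hxU) (t ^ Fintype.card K) =
      (X.presheaf.germ U x hxU) t ^ Fintype.card K := map_pow _ _ _
    rw [h2] at ha
    exact (isUnit_pow_iff Fintype.card_ne_zero).mp ha

theorem frobenius_apply (s : X ⟶ Spec (CommRingCat.of K)) (x : X) : frobenius s x = x := rfl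

theorem frobenius_app_apply (s : X ⟶ Spec (CommRingCat.of K)) (U : X.Opens) (r : Γ(X, U)) :
    (frobenius s).app U r = r ^ Fintype.card K := rfl

end Frobenius

/-! ### The underlying abelian sheaf of a sheaf of modules -/

section AbelianSheaf

open Limits

/-- The forgetful functor from `𝒪_X`-modules to sheaves of abelian groups. -/
def toAbSheaf (X : Scheme.{u}) : X.Modules ⥤ TopCat.Sheaf Ab.{u} X :=
  SheafOfModules.toSheaf X.ringCatSheaf

instance (X : Scheme.{u}) : (toAbSheaf X).Additive :=
  inferInstanceAs (SheafOfModules.toSheaf X.ringCatSheaf).Additive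

instance (X : Scheme.{u}) : PreservesColimitsOfSize.{0, 0} (toAbSheaf X) where
  preservesColimitsOfShape {J _} := ⟨fun {F} => by
    let R := X.ringCatSheaf
    let L := PresheafOfModules.sheafification.{u} (𝟙 R.obj)
    let G : SheafOfModules R ⥤ PresheafOfModules.{u} R.obj :=
      SheafOfModules.forget R ⋙ PresheafOfModules.restrictScalars (𝟙 R.obj)
    let adj : L ⊣ G := PresheafOfModules.sheafificationAdjunction (𝟙 R.obj)
    let F' : J ⥤ SheafOfModules R := F
    let e : (F' ⋙ G) ⋙ L ≅ F' := Functor.isoWhiskerLeft F' (asIso adj.counit)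
    have : PreservesColimitsOfShape J (L ⋙ SheafOfModules.toSheaf R) := by
      change PreservesColimitsOfShape J
        (PresheafOfModules.toPresheaf _ ⋙ presheafToSheaf _ Ab.{u})
      infer_instance
    have h1 : PreservesColimit ((F' ⋙ G) ⋙ L) (SheafOfModules.toSheaf R) := by
      have : PreservesColimitsOfSize.{0, 0} L := adj.leftAdjoint_preservesColimits
      apply preservesColimit_of_preserves_colimit_cocone
        (isColimitOfPreserves L (colimit.isColimit (F' ⋙ G)))
      exact isColimitOfPreserves (L ⋙ SheafOfModules.toSheaf R) (colimit.isColimit (F' ⋙ G))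
    exact preservesColimit_of_iso_diagram (SheafOfModules.toSheaf R) e⟩

end AbelianSheaf

/-! ### Cartier modules -/

variable {X : Scheme.{u}}

/-- A `q⁻¹`-linear map on an `𝒪_X`-module `M`: a morphism `C : M → M` of sheaves of abelian groups
with `C (r ^ q • m) = r • C m` for all local sections `r` of `𝒪_X` and `m` of `M`. A Cartier module
is a quasi-coherent `𝒪_X`-module with such a map. -/
structure CartierMap (q : ℕ) (M : X.Modules) where
  /-- the morphism of abelian sheaves -/
  hom : M.presheaf ⟶ M.presheaf
  map_pow_smul (U : X.Opens) (r : Γ(X, U)) (m : Γ(M, U)) :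
    hom.app (op U) (r ^ q • m) = r • hom.app (op U) m

namespace CartierMap

variable {q : ℕ} {M : X.Modules} (C : CartierMap q M)

/-- The map `C` on sections over `U`. -/
def app (U : X.Opens) : Γ(M, U) →+ Γ(M, U) := (C.hom.app (op U)).hom

/-- The map induced by `C` on the stalk `M_x`. -/
def stalkMap (x : X) : M.presheaf.stalk x →+ M.presheaf.stalk x :=
  ((TopCat.Presheaf.stalkFunctor Ab.{u} x).map C.hom).hom

/-- The crystalline support: the set of all points `x` such that `M_x` is not nilpotent. -/
def crysSupport : Set X := {x | ¬ ∃ e : ℕ, ∀ m, (C.stalkMap x)^[e] m = 0}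

/-- The ideal sheaf `I` is the annihilator of the submodule `C ^ e (M)`, for all large `e`. -/
def IsStableAnnihilator (I : X.IdealSheafData) : Prop :=
  ∃ e₀ : ℕ, ∀ e ≥ e₀, ∀ (U : X.affineOpens) (f : Γ(X, U)),
    f ∈ I.ideal U ↔ ∀ m : Γ(M, U), f • (C.app U)^[e] m = 0

/-- A Cartier submodule of `(M, C)`: a quasi-coherent `𝒪_X`-submodule `N` of `M` with
`C (N) ⊆ N`. -/
structure CartierSubmodule where
  /-- the `𝒪_X`-module `N` -/
  obj : X.Modules
  isQuasicoherent : obj.IsQuasicoherent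
  /-- the inclusion of `N` in `M` -/
  ι : obj ⟶ M
  mono : Mono ι
  stable (U : X.Opens) (n : Γ(obj, U)) : ∃ n' : Γ(obj, U), ι.app U n' = C.app U (ι.app U n)

end CartierMap

/-! ### The quotient of a Cartier module by a Cartier submodule -/

namespace CartierMap.CartierSubmodule

open Limits

variable {q : ℕ} {M : X.Modules} {C : CartierMap q M} (N : C.CartierSubmodule)

/-- The `𝒪_X`-module `M / N`. -/
def quotientModule : X.Modules := cokernel N.ι

/-- The projection `M → M / N`. -/
def π : M ⟶ N.quotientModule := cokernel.π N.ι

instance : Epi N.π := inferInstanceAs (Epi (cokernel.π N.ι))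

theorem ι_π : N.ι ≫ N.π = 0 := cokernel.condition N.ι

/-- `C` as a morphism of sheaves. -/
def sheafHom (C : CartierMap q M) : (toAbSheaf X).obj M ⟶ (toAbSheaf X).obj M := ⟨C.hom⟩

theorem comp_eq_zero :
    (toAbSheaf X).map N.ι ≫ sheafHom C ≫ (toAbSheaf X).map N.π = 0 := by
  apply CategoryTheory.Sheaf.hom_ext
  ext U n
  obtain ⟨n', h⟩ := N.stable U.unop n
  have h2 : N.π.app U.unop (N.ι.app U.unop n') = 0 := by
    rw [← ConcreteCategory.comp_apply, ← Scheme.Modules.Hom.comp_app, N.ι_π]; rfl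
  rw [h] at h2
  exact h2

/-- As an abelian sheaf, `M / N` is the cokernel of `N → M`. -/
def isColimit :=
  CokernelCofork.mapIsColimit _ (cokernelIsCokernel N.ι) (toAbSheaf X)

/-- The map induced by `C` on the abelian sheaf `M / N`. -/
def quotientSheafHom :
    (toAbSheaf X).obj N.quotientModule ⟶ (toAbSheaf X).obj N.quotientModule :=
  N.isColimit.desc (CokernelCofork.ofπ (sheafHom C ≫ (toAbSheaf X).map N.π) N.comp_eq_zero)

theorem π_quotientSheafHom :
    (toAbSheaf X).map N.π ≫ N.quotientSheafHom = sheafHom C ≫ (toAbSheaf X).map N.π :=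
  N.isColimit.fac _ WalkingParallelPair.one

theorem quotientSheafHom_app (U : X.Opens) (m : Γ(M, U)) :
    N.quotientSheafHom.hom.app (op U) (N.π.app U m) = N.π.app U (C.app U m) :=
  congr($(N.π_quotientSheafHom).hom.app (op U) m)

theorem exists_lift (U : X.Opens) (y : Γ(N.quotientModule, U)) (x : X)
    (hx : x ∈ U) : ∃ (V : X.Opens) (i : V ≤ U) (m : Γ(M, V)), x ∈ V ∧
      N.π.app V m = N.quotientModule.presheaf.map (homOfLE i).op y := by
  have h : Epi ((toAbSheaf X).map N.π) := inferInstance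
  rw [← TopCat.Sheaf.isLocallySurjective_iff_epi, TopCat.Presheaf.isLocallySurjective_iff] at h
  obtain ⟨V, i, ⟨m, hm⟩, hxV⟩ := h U y x hx
  exact ⟨V, i, m, hxV, hm⟩

/-- The Cartier module `M / N`: the `q⁻¹`-linear map induced by `C` on the quotient. -/
def quotient : CartierMap q N.quotientModule where
  hom := N.quotientSheafHom.hom
  map_pow_smul U r y := by
    refine TopCat.Presheaf.section_ext ⟨_, N.quotientModule.isSheaf⟩ U _ _ fun x hx => ?_
    obtain ⟨V, i, m, hxV, hm⟩ := N.exists_lift U y x hx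
    let D : Γ(N.quotientModule, U) →+ Γ(N.quotientModule, U) :=
      (N.quotientSheafHom.hom.app (op U)).hom
    let E : Γ(N.quotientModule, V) →+ Γ(N.quotientModule, V) :=
      (N.quotientSheafHom.hom.app (op V)).hom
    have hE (m : Γ(M, V)) : E (N.π.app V m) = N.π.app V (C.app V m) := N.quotientSheafHom_app V m
    have nat (z : Γ(N.quotientModule, U)) :
        N.quotientModule.presheaf.map (homOfLE i).op (D z) =
        E (N.quotientModule.presheaf.map (homOfLE i).op z) :=
      (NatTrans.naturality_apply N.quotientSheafHom.hom (homOfLE i).op z).symm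
    have key : N.quotientModule.presheaf.map (homOfLE i).op (D (r ^ q • y)) =
        N.quotientModule.presheaf.map (homOfLE i).op (r • D y) := by
      rw [nat, Scheme.Modules.map_smul, Scheme.Modules.map_smul, nat, ← hm, map_pow,
        ← Scheme.Modules.Hom.app_smul, hE, hE, ← Scheme.Modules.Hom.app_smul]
      exact congrArg _ (C.map_pow_smul V _ m)
    have h := congrArg (N.quotientModule.presheaf.germ V x hxV) key
    rw [TopCat.Presheaf.germ_res_apply, TopCat.Presheaf.germ_res_apply] at h
    exact h

theorem quotient_app_π (U : X.Opens) (m : Γ(M, U)) :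
    N.quotient.app U (N.π.app U m) = N.π.app U (C.app U m) := N.quotientSheafHom_app U m

end CartierMap.CartierSubmodule

/-- The collection of all crystalline supports `Supp_crys (M / N)`, where `N` runs through the
Cartier submodules of `(M, C)`. -/
def CartierMap.quotientSupports {q : ℕ} {M : X.Modules} (C : CartierMap q M) : Set (Set X) :=
  {Y | ∃ N : C.CartierSubmodule, Y = N.quotient.crysSupport}

end CartierCrystal

end

open CartierCrystal

/-! Over an affine open the data are a finitely generated module `A` over a Noetherian ring `R` with
a `q⁻¹`-linear map `C`. If `r ^ q` kills `C ^ e (A)`, then `r` kills `C ^ (e + 1) (A)`, so the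
stable annihilator is radical. Annihilators of `C ^ e` commute with localization, hence form an
ideal sheaf, whose zero set is the crystalline support (`exists_isStableAnnihilator`).

For finiteness, the images `C ^ e (A)` become stationary (`exists_iterRange_eq`, the
Hartshorne–Speiser–Lyubeznik–Gabber theorem), so one may assume that `C` is surjective. Annihilators
of quotients by stable submodules are then radical, and their minimal primes are again such
annihilators, so only prime ones must be bounded. By Noetherian induction it suffices that those
strictly above a prime `P₀` avoid a neighbourhood of `P₀` in `V(P₀)`. Dividing out nilpotents leads
to a module over the domain `R ⧸ P₀` without nilpotent submodules. By `F`-finiteness, the adjoint `A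
→ Hom(F_* R, A)` of `C` is then an injection between modules of equal generic rank, so it is
generically an isomorphism. For a general prime `P ≠ 0`, an element of `P` outside `P ^ 2` has a
coordinate over the `q`-th powers which is a unit at `P`. A stable `B ⊇ P • A` is therefore all of
`A` at `P` (`exists_generic_smul_mem`), and `P` is no annihilator. The ideals on a finite affine
cover determine the support.

Unions come from intersections of Cartier submodules. A component with generic point `x` is the
support of `M / N'`, where `N'` consists of the sections that are nilpotent in `(M / N)_x`.
Finiteness of the collection makes the resulting unions finite. -/

namespace CartierCrystal

/-! ### Modules with a `q⁻¹`-linear endomorphism -/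

section Algebra

/-- If every element of a finitely generated submodule has a multiple in `N'`, by an element of the
multiplicative set `S`, then these multipliers can be chosen uniformly. -/
theorem exists_smul_mem_of_fg {R V : Type*} [CommRing R] [AddCommGroup V] [Module R V]
    (S : Submonoid R) {N : Submodule R V} (hN : N.FG) (N' : Submodule R V)
    (h : ∀ b ∈ N, ∃ s ∈ S, s • b ∈ N') : ∃ s ∈ S, ∀ b ∈ N, s • b ∈ N' := by
  induction N, hN using Submodule.fg_induction with
  | singleton x =>
    obtain ⟨s, hs, hx⟩ := h x (Submodule.mem_span_singleton_self x)
    refine ⟨s, hs, fun b hb => ?_⟩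
    obtain ⟨r, rfl⟩ := Submodule.mem_span_singleton.mp hb
    rw [smul_comm]
    exact N'.smul_mem r hx
  | sup M₁ M₂ _ _ h₁ h₂ =>
    obtain ⟨s, hs, h₁⟩ := h₁ fun b hb => h b (Submodule.mem_sup_left hb)
    obtain ⟨t, ht, h₂⟩ := h₂ fun b hb => h b (Submodule.mem_sup_right hb)
    refine ⟨s * t, S.mul_mem hs ht, fun b hb => ?_⟩
    obtain ⟨b₁, hb₁, b₂, hb₂, rfl⟩ := Submodule.mem_sup.mp hb
    rw [smul_add]
    refine add_mem ?_ ?_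
    · rw [mul_comm, mul_smul]; exact N'.smul_mem t (h₁ _ hb₁)
    · rw [mul_smul]; exact N'.smul_mem s (h₂ _ hb₂)

/-- A descending chain of submodules which contain `I • V` becomes stationary at a minimal prime
of `I`. -/
theorem exists_smul_le_of_antitone {R V : Type*} [CommRing R] [IsNoetherianRing R]
    [AddCommGroup V] [Module R V] [Module.Finite R V] {I P : Ideal R} (hP : P ∈ I.minimalPrimes)
    (B : ℕ → Submodule R V) (hB : Antitone B) (hI : ∀ n, I • (⊤ : Submodule R V) ≤ B n) :
    ∃ n, ∃ s ∉ P, ∀ b ∈ B n, s • b ∈ B (n + 1) := by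
  have hprime : P.IsPrime := hP.1.1
  let S := Localization.AtPrime P
  let L := LocalizedModule P.primeCompl V
  let f : V →ₗ[R] L := LocalizedModule.mkLinearMap P.primeCompl V
  let B' (n : ℕ) : Submodule S L := (B n).localized' S P.primeCompl f
  let I' : Ideal S := I.map (algebraMap R S)
  have hmin : IsLocalRing.maximalIdeal S ∈ I'.minimalPrimes := by
    refine ⟨⟨inferInstance, ?_⟩, fun Q hQ _ => ?_⟩
    · rw [Ideal.map_le_iff_le_comap]
      exact hP.1.2.trans (IsLocalization.AtPrime.under_maximalIdeal S P).ge
    · have := hQ.1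
      have h1 : P ≤ Q.comap (algebraMap R S) := by
        refine hP.2 ⟨inferInstance, Ideal.map_le_iff_le_comap.mp hQ.2⟩ ?_
        exact (Ideal.comap_mono (IsLocalRing.le_maximalIdeal this.ne_top)).trans
          (IsLocalization.AtPrime.under_maximalIdeal S P).le
      rw [← Localization.AtPrime.map_eq_maximalIdeal]
      exact Ideal.map_le_iff_le_comap.mpr h1
  -- Now `L / I'L` has finite length over `R_P`, so the localized chain, which stays above `I'L`,
  -- must stop.
  have hart : IsArtinianRing (S ⧸ I') :=
    IsLocalRing.quotient_artinian_of_mem_minimalPrimes_of_isLocalRing I' hmin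
  have hfin : Module.Finite S L := Module.Finite.of_isLocalizedModule P.primeCompl f
  let K : Submodule S L := I' • ⊤
  have hartL : IsArtinian S (L ⧸ K) := by
    have h1 : IsArtinian (S ⧸ I') (L ⧸ K) := by
      have : Module.Finite (S ⧸ I') (L ⧸ K) := Module.Finite.of_restrictScalars_finite S _ _
      infer_instance
    exact isArtinian_of_surjective_algebraMap (R := S ⧸ I') (S := S) Ideal.Quotient.mk_surjective
  have hK (n : ℕ) : K ≤ B' n := by
    refine Submodule.smul_le.mpr fun r hr x _ => ?_
    induction hr using Submodule.span_induction with
    | mem r hr =>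
      obtain ⟨i, hi, rfl⟩ := hr
      obtain ⟨⟨v, t⟩, rfl⟩ := IsLocalizedModule.mk'_surjective P.primeCompl f x
      refine ⟨i • v, hI n (Submodule.smul_mem_smul hi trivial), t, ?_⟩
      rw [Function.uncurry_apply_pair, IsLocalizedModule.mk'_smul, algebraMap_smul]
    | zero => rw [zero_smul]; exact zero_mem _
    | add r s _ _ hr hs => rw [add_smul]; exact add_mem hr hs
    | smul c r _ hr => rw [smul_eq_mul, mul_smul]; exact Submodule.smul_mem _ _ hr
  have hB' : Antitone B' := by
    rintro i j hij _ ⟨b, hb, s, rfl⟩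
    exact ⟨b, hB hij hb, s, rfl⟩
  obtain ⟨n, hn⟩ := IsArtinian.monotone_stabilizes (R := S) (M := L ⧸ K)
    ⟨fun n => OrderDual.toDual ((B' n).map K.mkQ), fun i j h => Submodule.map_mono (hB' h)⟩
  have hn1 : B' n = B' (n + 1) := by
    have h : (B' n).map K.mkQ = (B' (n + 1)).map K.mkQ := hn (n + 1) (Nat.le_succ n)
    have h2 := congrArg (Submodule.comap K.mkQ) h
    rwa [Submodule.comap_map_mkQ, Submodule.comap_map_mkQ, sup_eq_right.mpr (hK _),
      sup_eq_right.mpr (hK _)] at h2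
  refine ⟨n, exists_smul_mem_of_fg P.primeCompl (IsNoetherian.noetherian _) _ fun b hb => ?_⟩
  have h4 : f b ∈ B' (n + 1) := by
    rw [← hn1]
    exact ⟨b, hb, 1, by simp⟩
  obtain ⟨c, hc, t, htc⟩ := h4
  rw [IsLocalizedModule.mk'_eq_iff] at htc
  obtain ⟨v, hv⟩ := (IsLocalizedModule.eq_iff_exists P.primeCompl f).mp
    (htc.trans (f.map_smul (t : R) b).symm)
  refine ⟨v * t, (v * t).2, ?_⟩
  rw [mul_smul]
  exact hv ▸ (B (n + 1)).smul_mem (v : R) hc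

variable {R A : Type*} [CommRing R] [AddCommGroup A] [Module R A] {q : ℕ} {C : A →+ A}

theorem iterate_pow_smul (hC : ∀ (r : R) (a : A), C (r ^ q • a) = r • C a) (e : ℕ) (r : R) (a : A) :
    C^[e] (r ^ q ^ e • a) = r • C^[e] a := by
  induction e generalizing r a with
  | zero => simp
  | succ e ih =>
    rw [Function.iterate_succ_apply, pow_succ, pow_mul, hC, ih, Function.iterate_succ_apply]

/-- The submodule `C ^ e (A)`. -/
def iterRange (hC : ∀ (r : R) (a : A), C (r ^ q • a) = r • C a) (e : ℕ) : Submodule R A where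
  carrier := Set.range C^[e]
  add_mem' := by
    rintro _ _ ⟨a, rfl⟩ ⟨b, rfl⟩
    exact ⟨a + b, iterate_map_add C e a b⟩
  zero_mem' := ⟨0, iterate_map_zero C e⟩
  smul_mem' := by
    rintro r _ ⟨a, rfl⟩
    exact ⟨r ^ q ^ e • a, iterate_pow_smul hC e r a⟩

theorem iterRange_antitone (hC : ∀ (r : R) (a : A), C (r ^ q • a) = r • C a) :
    Antitone (iterRange hC) := by
  refine antitone_nat_of_succ_le fun e => ?_
  rintro _ ⟨a, rfl⟩
  exact ⟨C a, rfl⟩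

/-- The descending chain of the submodules `C ^ e (A)` becomes stationary. -/
theorem exists_iterRange_eq [IsNoetherianRing R] [Module.Finite R A] (hq : 2 ≤ q)
    (hC : ∀ (r : R) (a : A), C (r ^ q • a) = r • C a) :
    ∃ e₀, ∀ e ≥ e₀, iterRange hC e = iterRange hC e₀ := by
  -- The transporter of `C ^ e (A)` into `C ^ (e + 1) (A)`. It increases with `e`; the aim is that
  -- its limit is the unit ideal.
  let J (e : ℕ) : Ideal R :=
    { carrier := {r | ∀ a ∈ iterRange hC e, r • a ∈ iterRange hC (e + 1)}
      add_mem' := fun {r s} hr hs a ha => by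
        rw [add_smul]; exact add_mem (hr a ha) (hs a ha)
      zero_mem' := fun a _ => by rw [zero_smul]; exact zero_mem _
      smul_mem' := fun c r hr a ha => by
        rw [smul_eq_mul, mul_smul]; exact Submodule.smul_mem _ _ (hr a ha) }
  have hsucc (e : ℕ) (a : A) (ha : a ∈ iterRange hC e) : C a ∈ iterRange hC (e + 1) := by
    obtain ⟨b, rfl⟩ := ha
    exact ⟨b, Function.iterate_succ_apply' _ _ _⟩
  have hpre (e : ℕ) (a : A) (ha : a ∈ iterRange hC (e + 1)) : ∃ b ∈ iterRange hC e, C b = a := by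
    obtain ⟨b, rfl⟩ := ha
    exact ⟨_, ⟨b, rfl⟩, (Function.iterate_succ_apply' _ _ _).symm⟩
  have hmul (e : ℕ) (r : R) (h : r ^ q ∈ J e) : r ∈ J (e + 1) := by
    intro a ha
    obtain ⟨b, hb, rfl⟩ := hpre e a ha
    rw [← hC]
    exact hsucc _ _ (h b hb)
  have hJ : Monotone J := monotone_nat_of_le_succ fun e r hr => hmul e r
    (Ideal.pow_mem_of_mem _ hr q (by omega))
  obtain ⟨e₀, he₀⟩ := monotone_stabilizes_iff_noetherian.mpr ‹IsNoetherianRing R› ⟨J, hJ⟩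
  replace he₀ : ∀ e ≥ e₀, J e = J e₀ := fun e he => (he₀ e he).symm
  -- If `s • a = C b`, then `(r * s) • a = C (r ^ q • b)` with `r ^ q ∈ J ^ q ⊆ J ^ 2`. Iterating,
  -- `J ^ 2 • C ^ e₀ (A)` lies in every later image.
  have hsq (x : A) (hx : x ∈ (J e₀ * J e₀) • iterRange hC e₀) :
      ∃ y ∈ (J e₀ * J e₀) • iterRange hC e₀, C y = x := by
    induction hx using Submodule.smul_induction_on' with
    | smul t ht a ha =>
      induction ht using Submodule.mul_induction_on' with
      | mem_mul_mem r hr s hs =>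
        obtain ⟨b, hb, h⟩ := hpre _ _ (hs a ha)
        refine ⟨r ^ q • b, Submodule.smul_mem_smul ?_ hb, ?_⟩
        · rw [← pow_two]
          exact Ideal.pow_le_pow_right hq (Ideal.pow_mem_pow hr q)
        · rw [hC, h, mul_smul]
      | add t _ t' _ h h' =>
        obtain ⟨y, hy, h⟩ := h
        obtain ⟨y', hy', h'⟩ := h'
        exact ⟨y + y', add_mem hy hy', by rw [map_add, h, h', add_smul]⟩
    | add x _ x' _ h h' =>
      obtain ⟨y, hy, h⟩ := h
      obtain ⟨y', hy', h'⟩ := h'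
      exact ⟨y + y', add_mem hy hy', by rw [map_add, h, h']⟩
  have hle (k : ℕ) : (J e₀ * J e₀) • iterRange hC e₀ ≤ iterRange hC (e₀ + k) := by
    induction k with
    | zero => exact Submodule.smul_le_right
    | succ k ih =>
      intro x hx
      obtain ⟨y, hy, rfl⟩ := hsq x hx
      exact hsucc _ _ (ih hy)
  have htop : J e₀ = ⊤ := by
    by_contra hne
    have hne' : J e₀ * J e₀ ≠ ⊤ := fun h => hne (top_le_iff.mp (h.ge.trans Ideal.mul_le_left))
    -- At a minimal prime `P` of `J ^ 2` the chain of images stops, which yields an element of `J`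
    -- outside `P`, although `J ⊆ P`.
    obtain ⟨P, hP⟩ := Ideal.nonempty_minimalPrimes hne'
    have hprime : P.IsPrime := hP.1.1
    obtain ⟨n, s, hs, h⟩ := exists_smul_le_of_antitone (V := iterRange hC e₀) hP
      (fun n => (iterRange hC (e₀ + n)).comap (iterRange hC e₀).subtype)
      (fun i j hij => Submodule.comap_mono (iterRange_antitone hC (by omega)))
      (fun n => by
        rw [← Submodule.map_le_iff_le_comap, Submodule.map_smul'', Submodule.map_subtype_top]
        exact hle n)
    have hsJ : s ∈ J (e₀ + n) := fun a ha => h ⟨a, iterRange_antitone hC (by omega) ha⟩ ha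
    rw [he₀ _ (by omega)] at hsJ
    rcases (Ideal.IsPrime.mul_le hprime).mp hP.1.2 with h | h <;> exact hs (h hsJ)
  refine ⟨e₀, fun e he => ?_⟩
  induction e, he using Nat.le_induction with
  | base => rfl
  | succ e he ih =>
    refine le_antisymm (iterRange_antitone hC (by omega)) fun a ha => ?_
    have h1 : (1 : R) ∈ J e := by rw [he₀ e he, htop]; trivial
    simpa using h1 a (ih ▸ ha)

end Algebra

/-! ### Generic behaviour over a domain -/

section Generic

/-- A finitely generated module over a domain is free up to a nonzero denominator: there are
linearly independent elements whose span contains `g • A` with `g ≠ 0`. -/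
theorem exists_linearIndependent_smul_mem_span {R A : Type*} [CommRing R] [IsDomain R]
    [AddCommGroup A] [Module R A] [Module.Finite R A] :
    ∃ (d : ℕ) (m : Fin d → A), LinearIndependent R m ∧
      ∃ g : R, g ≠ 0 ∧ ∀ a, g • a ∈ Submodule.span R (Set.range m) := by
  obtain ⟨k, v, hv⟩ := Module.Finite.exists_fin (R := R) (M := A)
  -- Generators outside a maximal independent subfamily have nonzero multiples in its span.
  obtain ⟨s, hs, hmax⟩ := exists_maximal_linearIndepOn R v
  obtain ⟨d, ⟨e⟩⟩ := Finite.exists_equiv_fin s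
  have hrange : Set.range ((fun i : s => v i) ∘ e.symm) = v '' s := by
    rw [e.symm.surjective.range_comp, Set.image_eq_range]
  refine ⟨d, (fun i : s => v i) ∘ e.symm, hs.comp _ e.symm.injective, ?_⟩
  rw [hrange]
  have hfg : (⊤ : Submodule R A).FG := Module.Finite.fg_top
  obtain ⟨g, hg, h⟩ := exists_smul_mem_of_fg (nonZeroDivisors R) hfg
    (Submodule.span R (v '' s)) fun b _ => by
      have hb : b ∈ Submodule.span R (Set.range v) := hv ▸ trivial
      induction hb using Submodule.span_induction with
      | mem x hx =>
        obtain ⟨i, rfl⟩ := hx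
        by_cases hi : i ∈ s
        · exact ⟨1, one_mem _, by rw [one_smul]; exact Submodule.subset_span ⟨i, hi, rfl⟩⟩
        · obtain ⟨a, ha, h⟩ := hmax i hi
          exact ⟨a, mem_nonZeroDivisors_of_ne_zero ha, h⟩
      | zero => exact ⟨1, one_mem _, by rw [smul_zero]; exact zero_mem _⟩
      | add x y _ _ hx hy =>
        obtain ⟨a, ha, hx⟩ := hx trivial
        obtain ⟨b, hb, hy⟩ := hy trivial
        refine ⟨a * b, mul_mem ha hb, ?_⟩
        rw [smul_add]
        refine add_mem ?_ ?_
        · rw [mul_comm, mul_smul]; exact Submodule.smul_mem _ b hx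
        · rw [mul_smul]; exact Submodule.smul_mem _ a hy
      | smul r x _ hx =>
        obtain ⟨a, ha, hx⟩ := hx trivial
        exact ⟨a, ha, by rw [smul_comm]; exact Submodule.smul_mem _ r hx⟩
  exact ⟨g, nonZeroDivisors.ne_zero hg, fun a => h a trivial⟩

/-- The ring `R` is generated by finitely many elements as a module over its `q`-th powers. -/
def IsFrobeniusFinite (q : ℕ) (R : Type*) [CommRing R] : Prop :=
  ∃ (n : ℕ) (b : Fin n → R), ∀ r, ∃ c : Fin n → R, r = ∑ i, c i ^ q * b i

variable {R : Type*} [CommRing R] {q : ℕ}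

theorem IsFrobeniusFinite.quotient (h : IsFrobeniusFinite q R) (I : Ideal R) :
    IsFrobeniusFinite q (R ⧸ I) := by
  obtain ⟨n, b, h⟩ := h
  refine ⟨n, fun i => Ideal.Quotient.mk I (b i), fun r => ?_⟩
  obtain ⟨r, rfl⟩ := Ideal.Quotient.mk_surjective r
  obtain ⟨c, hc⟩ := h r
  refine ⟨fun i => Ideal.Quotient.mk I (c i), ?_⟩
  conv_lhs => rw [hc]
  simp [map_sum]

/-- Over a domain, one can choose generators of `R` over its `q`-th powers, up to a nonzero
denominator `f`, which are linearly independent. -/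
theorem IsFrobeniusFinite.exists_independent [IsDomain R] (h : IsFrobeniusFinite q R) (hq : q ≠ 0)
    (hadd : ∀ r s : R, (r + s) ^ q = r ^ q + s ^ q) :
    ∃ (n : ℕ) (b : Fin n → R), (∀ c : Fin n → R, ∑ i, c i ^ q * b i = 0 → ∀ i, c i = 0) ∧
      ∃ f : R, f ≠ 0 ∧ ∀ r, ∃ c : Fin n → R, f ^ q * r = ∑ i, c i ^ q * b i := by
  let φ : R →+* R :=
    { toFun r := r ^ q
      map_one' := one_pow q
      map_mul' r s := mul_pow r s q
      map_zero' := zero_pow hq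
      map_add' := hadd }
  obtain ⟨k, v, hv⟩ := h
  -- `R` is viewed as a module over itself through `r ↦ r ^ q`, so the denominator `f` acts as `f ^
  -- q`.
  let : Module R R := Module.compHom R φ
  have hfin : Module.Finite R R := by
    refine ⟨(Set.finite_range v).toFinset, eq_top_iff.mpr fun r _ => ?_⟩
    obtain ⟨c, hc⟩ := hv r
    rw [hc]
    exact sum_mem fun i _ => Submodule.smul_mem _ (c i) (Submodule.subset_span (by simp))
  obtain ⟨n, b, hb, f, hf, hspan⟩ := exists_linearIndependent_smul_mem_span (R := R) (A := R)
  refine ⟨n, b, Fintype.linearIndependent_iff.mp hb, f, hf, fun r => ?_⟩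
  obtain ⟨c, hc⟩ := (Submodule.mem_span_range_iff_exists_fun R).mp (hspan r)
  exact ⟨c, hc.symm⟩

/-- In a Noetherian domain, the elements of a nonzero prime ideal `P` are not all contained in
`P ^ 2` up to a denominator outside of `P`. -/
theorem exists_mul_notMem_sq [IsDomain R] [IsNoetherianRing R] {P : Ideal R} [P.IsPrime]
    (hP : P ≠ ⊥) {f : R} (hf : f ∉ P) : ∃ r ∈ P, f * r ∉ P * P := by
  by_contra! h
  let S := Localization.AtPrime P
  let Q : Ideal S := P.map (algebraMap R S)
  have hu : IsUnit (algebraMap R S f) := IsLocalization.map_units S (⟨f, hf⟩ : P.primeCompl)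
  -- Since `f` is a unit in `R_P`, the ideal `P R_P` equals its square and vanishes by Nakayama.
  have hQ : Q ≤ Q • Q := by
    refine Ideal.map_le_iff_le_comap.mpr fun r hr => ?_
    have h1 : algebraMap R S (f * r) ∈ (P * P).map (algebraMap R S) :=
      Ideal.mem_map_of_mem _ (h r hr)
    rw [Ideal.map_mul, map_mul] at h1
    exact (Ideal.unit_mul_mem_iff_mem _ hu).mp h1
  have hbot : Q = ⊥ := by
    refine Submodule.eq_bot_of_le_smul_of_le_jacobson_bot Q Q (IsNoetherian.noetherian _) hQ ?_
    rw [IsLocalRing.jacobson_eq_maximalIdeal _ bot_ne_top]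
    exact (Localization.AtPrime.map_eq_maximalIdeal (I := P)).le
  refine hP (eq_bot_iff.mpr fun r hr => ?_)
  have h1 : algebraMap R S r ∈ Q := Ideal.mem_map_of_mem _ hr
  rw [hbot] at h1
  exact IsLocalization.injective S P.primeCompl_le_nonZeroDivisors (by simpa using h1)

/-- Over a domain, if `A` has no nonzero nilpotent submodule, then away from a proper closed subset
a submodule of `A` which is stable under `C` and contains `P • A` is all of `A`. -/
theorem exists_generic_smul_mem [IsDomain R] [IsNoetherianRing R] (hR : IsFrobeniusFinite q R)
    (hq : 2 ≤ q) (hadd : ∀ r s : R, (r + s) ^ q = r ^ q + s ^ q)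
    {A : Type*} [AddCommGroup A] [Module R A] [Module.Finite R A] {C : A →+ A}
    (hC : ∀ (r : R) (a : A), C (r ^ q • a) = r • C a)
    (hnil : ∀ a : A, (∀ r : R, C (r • a) = 0) → a = 0) :
    ∃ f : R, f ≠ 0 ∧ ∀ P : Ideal R, P.IsPrime → P ≠ ⊥ → f ∉ P → ∀ B : Submodule R A,
      (∀ a ∈ B, C a ∈ B) → (∀ r ∈ P, ∀ a, r • a ∈ B) → ∃ s ∉ P, ∀ a, s • a ∈ B := by
  obtain ⟨d, m, hm, g, hg, hspan⟩ := exists_linearIndependent_smul_mem_span (R := R) (A := A)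
  obtain ⟨n, b, hb, f, hf, hgen⟩ := hR.exists_independent (by omega) hadd
  have hcoord (a : A) : ∃ c : Fin d → R, g • a = ∑ j, c j • m j := by
    obtain ⟨c, hc⟩ := (Submodule.mem_span_range_iff_exists_fun R).mp (hspan a)
    exact ⟨c, hc.symm⟩
  choose c hc using hcoord
  -- the matrix of `a ↦ (g • C (b i' • a))` in terms of the `b i • m j`
  let G : Matrix (Fin n × Fin d) (Fin n × Fin d) R :=
    fun x y => c (C ((b y.1 * b x.1) • m x.2)) y.2
  -- Up to denominators every element of `A` is some `el v`. As `C` takes `q`-th roots of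
  -- coefficients, `C (b i • el v)` is `R`-linear in `v`.
  let el (v : Fin n × Fin d → R) : A := ∑ x, (v x ^ q * b x.1) • m x.2
  have hel (v : Fin n × Fin d → R) (i : Fin n) :
      g • C (b i • el v) = ∑ j, (Matrix.vecMul v G) (i, j) • m j := by
    have h1 : C (b i • el v) = ∑ x, v x • C ((b i * b x.1) • m x.2) := by
      simp only [el, Finset.smul_sum, map_sum]
      refine Finset.sum_congr rfl fun x _ => ?_
      rw [← hC, smul_smul, smul_smul]
      congr 2; ring
    rw [h1, Finset.smul_sum]
    have h2 (x : Fin n × Fin d) : g • v x • C ((b i * b x.1) • m x.2) =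
        ∑ j, (v x * G x (i, j)) • m j := by
      rw [smul_comm, hc, Finset.smul_sum]
      exact Finset.sum_congr rfl fun j _ => smul_smul _ _ _
    simp only [h2]
    rw [Finset.sum_comm]
    refine Finset.sum_congr rfl fun j _ => ?_
    rw [← Finset.sum_smul]
    rfl
  -- Injectivity of the adjoint: the `b i` generate `R` over its `q`-th powers up to `f ^ q`, so
  -- under this hypothesis `C` kills all multiples of `(f * g) ^ q • el v`.
  have hel0 (v : Fin n × Fin d → R) (h : ∀ i, g • C (b i • el v) = 0) : v = 0 := by
    have h1 : f ^ q • g ^ q • el v = 0 := by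
      refine hnil _ fun r => ?_
      obtain ⟨t, ht⟩ := hgen r
      rw [show r • f ^ q • g ^ q • el v = g ^ q • (f ^ q * r) • el v by
        simp only [smul_smul]; congr 1; ring, hC, ht, Finset.sum_smul, map_sum, Finset.smul_sum]
      refine Finset.sum_eq_zero fun i _ => ?_
      rw [mul_smul, hC, smul_comm, h, smul_zero]
    have h2 : ∑ j, (∑ i, (f * g * v (i, j)) ^ q * b i) • m j = 0 := by
      rw [← h1, smul_smul]
      simp only [el, Finset.smul_sum, Fintype.sum_prod_type, Finset.sum_smul]
      rw [Finset.sum_comm]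
      refine Finset.sum_congr rfl fun i _ => Finset.sum_congr rfl fun j _ => ?_
      rw [smul_smul]
      congr 1; ring
    funext ⟨i, j⟩
    have h3 := hb _ (Fintype.linearIndependent_iff.mp hm _ h2 j) i
    simpa [hf, hg] using h3
  have hdet : G.det ≠ 0 := by
    intro h0
    obtain ⟨v, hv, hvG⟩ := Matrix.exists_vecMul_eq_zero_iff.mpr h0
    exact hv (hel0 v fun i => by rw [hel, hvG]; simp)
  -- The adjugate inverts `G` up to its determinant, so the adjoint is also generically surjective.
  have hdual (i₀ : Fin n) (j₀ : Fin d) : ∃ a : A, ∀ i,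
      g • C (b i • a) = if i = i₀ then G.det • m j₀ else 0 := by
    refine ⟨el (Matrix.adjugate G (i₀, j₀)), fun i => ?_⟩
    rw [hel]
    have h1 : Matrix.vecMul (Matrix.adjugate G (i₀, j₀)) G = (Matrix.adjugate G * G) (i₀, j₀) := by
      funext y; rfl
    rw [h1, Matrix.adjugate_mul]
    simp only [Matrix.smul_apply, Matrix.one_apply, Prod.mk.injEq, smul_eq_mul]
    split_ifs with h
    · subst h
      simp [ite_smul]
    · refine Finset.sum_eq_zero fun j _ => ?_
      rw [if_neg (fun h' => h h'.1.symm), mul_zero, zero_smul]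
  refine ⟨f * (g * G.det), mul_ne_zero hf (mul_ne_zero hg hdet), ?_⟩
  intro P hP hP0 hfP B hB hPB
  have hfP' : f ∉ P := fun h => hfP (P.mul_mem_right _ h)
  have hgP : g * G.det ∉ P := fun h => hfP (P.mul_mem_left _ h)
  -- If all coordinates `t i` of `f ^ q * r` were in `P`, then `t i ^ q ∈ P ^ 2` would force `f ^ q
  -- * r ∈ P ^ 2`.
  obtain ⟨r, hr, hrP⟩ := exists_mul_notMem_sq hP0
    (fun h => hfP' (hP.mem_of_pow_mem q h) : f ^ q ∉ P)
  obtain ⟨t, ht⟩ := hgen r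
  obtain ⟨i₀, hi₀⟩ : ∃ i, t i ∉ P := by
    by_contra! h
    refine hrP ?_
    rw [ht]
    refine sum_mem fun i _ => Ideal.mul_mem_right _ _ ?_
    rw [← pow_two]
    exact Ideal.pow_le_pow_right hq (Ideal.pow_mem_pow (h i) q)
  -- `C (r • a)` lies in `B` because `r ∈ P`; the dual element `a` isolates the coordinate `t i₀`, a
  -- unit at `P`.
  have hmem (j : Fin d) : (t i₀ * G.det) • m j ∈ B := by
    obtain ⟨a, ha⟩ := hdual i₀ j
    have h1 : (g * f) • C (r • a) = (t i₀ * G.det) • m j := by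
      rw [mul_smul, ← hC, smul_smul, ht, Finset.sum_smul, map_sum, Finset.smul_sum,
        Finset.sum_eq_single i₀, mul_smul, hC, smul_comm, ha, if_pos rfl, smul_smul]
      · intro i _ hi
        rw [mul_smul, hC, smul_comm, ha, if_neg hi, smul_zero]
      · simp
    rw [← h1]
    exact B.smul_mem _ (hB _ (hPB r hr a))
  refine ⟨t i₀ * (g * G.det), fun h => (hP.mem_or_mem h).elim hi₀ hgP, fun a => ?_⟩
  have h1 : (t i₀ * (g * G.det)) • a = ∑ j, c a j • (t i₀ * G.det) • m j := by
    rw [show t i₀ * (g * G.det) = (t i₀ * G.det) * g by ring, mul_smul, hc, Finset.smul_sum]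
    exact Finset.sum_congr rfl fun j _ => smul_comm _ _ _
  rw [h1]
  exact sum_mem fun j _ => B.smul_mem _ (hmem j)

end Generic

/-! ### Finiteness of the set of annihilators -/

section Finiteness

/-- Otherwise some prime containing `I` avoids both `x` and the complement of `P`, so it is strictly
smaller than `P`. -/
theorem exists_mul_pow_mem_of_mem_minimalPrimes {R : Type*} [CommRing R] {I P : Ideal R}
    (hP : P ∈ I.minimalPrimes) {x : R} (hx : x ∈ P) : ∃ y ∉ P, ∃ n : ℕ, y * x ^ n ∈ I := by
  have hprime : P.IsPrime := hP.1.1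
  by_contra! h
  have hdisj : Disjoint (I : Set R) (P.primeCompl ⊔ Submonoid.powers x : Submonoid R) := by
    rw [Set.disjoint_left]
    intro z hz hz'
    obtain ⟨y, hy, _, ⟨n, rfl⟩, rfl⟩ := Submonoid.mem_sup.mp hz'
    exact h y hy n hz
  obtain ⟨Q, hQ, hIQ, hQd⟩ := Ideal.exists_le_prime_disjoint I _ hdisj
  have hQP : Q ≤ P := fun z hz => by
    by_contra hzP
    exact Set.disjoint_left.mp hQd hz (Submonoid.mem_sup_left (show z ∈ P.primeCompl from hzP))
  exact Set.disjoint_left.mp hQd (hP.2 ⟨hQ, hIQ⟩ hQP hx)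
    (Submonoid.mem_sup_right (Submonoid.mem_powers x))

/-- A set of prime ideals in a Noetherian ring is finite if each prime ideal `P₀` has an open
neighbourhood in `V(P₀)` which contains no member of the set besides `P₀`. -/
theorem finite_of_forall_exists_notMem {R : Type*} [CommRing R] [IsNoetherianRing R]
    {T : Set (Ideal R)} (hT : ∀ P ∈ T, P.IsPrime)
    (h : ∀ P₀ : Ideal R, P₀.IsPrime → ∃ f ∉ P₀, ∀ P ∈ T, P₀ ≤ P → f ∉ P → P = P₀) :
    T.Finite := by
  -- Noetherian induction on `V(J)`: for prime `J` the hypothesis removes an open part, otherwise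
  -- `V(J)` is a union of two smaller closed sets.
  suffices H : ∀ J : Ideal R, {P ∈ T | J ≤ P}.Finite by simpa using H ⊥
  intro J
  induction J using IsNoetherian.induction with
  | hgt J ih =>
  have ih' (x : R) (hx : x ∉ J) : {P ∈ T | J ⊔ Ideal.span {x} ≤ P}.Finite := by
    refine ih _ (lt_of_le_of_ne le_sup_left fun he => hx ?_)
    rw [he]
    exact Ideal.mem_sup_right (Ideal.mem_span_singleton_self x)
  by_cases htop : J = ⊤
  · refine Set.finite_empty.subset ?_
    rintro P ⟨hP, hJ⟩
    exact absurd (top_le_iff.mp (htop ▸ hJ)) (hT P hP).ne_top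
  by_cases hJ : Ideal.IsPrime J
  · obtain ⟨f, hf, hfJ⟩ := h J hJ
    refine ((ih' f hf).union (Set.finite_singleton J)).subset ?_
    rintro P ⟨hP, hJP⟩
    by_cases hfP : f ∈ P
    · exact Or.inl ⟨hP, sup_le hJP (by rwa [Ideal.span_singleton_le_iff_mem])⟩
    · exact Or.inr (hfJ P hP hJP hfP)
  · obtain ⟨x, hx, y, hy, hxy⟩ := (Ideal.not_isPrime_iff.mp hJ).resolve_left htop
    refine ((ih' x hx).union (ih' y hy)).subset ?_
    rintro P ⟨hP, hJP⟩
    rcases (hT P hP).mem_or_mem (hJP hxy) with h | h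
    · exact Or.inl ⟨hP, sup_le hJP (by rwa [Ideal.span_singleton_le_iff_mem])⟩
    · exact Or.inr ⟨hP, sup_le hJP (by rwa [Ideal.span_singleton_le_iff_mem])⟩

theorem iterate_mem_of_stable {R A : Type*} [CommRing R] [AddCommGroup A] [Module R A] {C : A →+ A}
    {B : Submodule R A} (hB : ∀ a ∈ B, C a ∈ B) (e : ℕ) {a : A}
    (ha : a ∈ B) : C^[e] a ∈ B := by
  induction e with
  | zero => exact ha
  | succ e ih => rw [Function.iterate_succ_apply']; exact hB _ ih

variable {R : Type*} [CommRing R] [IsNoetherianRing R] {q : ℕ}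
  {A : Type*} [AddCommGroup A] [Module R A] [Module.Finite R A] {C : A →+ A}

/-- The annihilators of quotients of `A` by stable submodules which are prime and lie over a given
prime ideal `P₀` do not accumulate at `P₀`. -/
theorem exists_notMem_forall_eq_of_surjective (hR : IsFrobeniusFinite q R) (hq : 2 ≤ q)
    (hadd : ∀ r s : R, (r + s) ^ q = r ^ q + s ^ q)
    (hC : ∀ (r : R) (a : A), C (r ^ q • a) = r • C a) (hsurj : Function.Surjective C)
    (P₀ : Ideal R) [P₀.IsPrime] :
    ∃ f ∉ P₀, ∀ P : Ideal R, P.IsPrime → P₀ ≤ P → f ∉ P → ∀ B : Submodule R A,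
      (∀ a ∈ B, C a ∈ B) → (∀ r, r ∈ P ↔ ∀ a, r • a ∈ B) → P = P₀ := by
  -- `N₀` is the smallest stable submodule containing `P₀ • A`; every `B` in question contains it
  -- because `P₀ ≤ P`.
  let 𝒩 : Set (Submodule R A) := {N | (∀ a ∈ N, C a ∈ N) ∧ ∀ r ∈ P₀, ∀ a, r • a ∈ N}
  let N₀ : Submodule R A := sInf 𝒩
  have hN₀ : N₀ ∈ 𝒩 := by
    refine ⟨fun a ha => ?_, fun r hr a => ?_⟩
    · exact Submodule.mem_sInf.mpr fun N hN => hN.1 _ (Submodule.mem_sInf.mp ha N hN)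
    · exact Submodule.mem_sInf.mpr fun N hN => hN.2 r hr a
  -- A maximal stable `W` that is nilpotent modulo `N₀` is divided out, which gives an `R ⧸
  -- P₀`-module satisfying the non-nilpotence hypothesis of `exists_generic_smul_mem`.
  let 𝒲 : Set (Submodule R A) :=
    {W | N₀ ≤ W ∧ (∀ a ∈ W, C a ∈ W) ∧ ∃ e, ∀ a ∈ W, C^[e] a ∈ N₀}
  obtain ⟨W, ⟨hNW, hW, e, he⟩, hmax⟩ := set_has_maximal_iff_noetherian.mpr
    (inferInstance : IsNoetherian R A) 𝒲 ⟨N₀, le_rfl, hN₀.1, 0, fun a ha => ha⟩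
  have htors : Module.IsTorsionBySet R (A ⧸ W) (P₀ : Set R) := by
    rintro a ⟨r, hr⟩
    obtain ⟨a, rfl⟩ := W.mkQ_surjective a
    rw [← map_smul]
    exact (Submodule.Quotient.mk_eq_zero W).mpr (hNW (hN₀.2 r hr a))
  let : Module (R ⧸ P₀) (A ⧸ W) := htors.module
  have hmk (r : R) (a : A) : (Ideal.Quotient.mk P₀ r) • W.mkQ a = W.mkQ (r • a) := rfl
  have hfin : Module.Finite (R ⧸ P₀) (A ⧸ W) := Module.Finite.of_restrictScalars_finite R _ _
  let D : A ⧸ W →+ A ⧸ W := QuotientAddGroup.lift W.toAddSubgroup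
    (W.mkQ.toAddMonoidHom.comp C) fun a ha => (Submodule.Quotient.mk_eq_zero W).mpr (hW a ha)
  have hD (a : A) : D (W.mkQ a) = W.mkQ (C a) := rfl
  have hDlin (r : R ⧸ P₀) (a : A ⧸ W) : D (r ^ q • a) = r • D a := by
    obtain ⟨r, rfl⟩ := Ideal.Quotient.mk_surjective r
    obtain ⟨a, rfl⟩ := W.mkQ_surjective a
    rw [← map_pow, hmk, hD, hC, hD, hmk]
  have hadd' (r s : R ⧸ P₀) : (r + s) ^ q = r ^ q + s ^ q := by
    obtain ⟨r, rfl⟩ := Ideal.Quotient.mk_surjective r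
    obtain ⟨s, rfl⟩ := Ideal.Quotient.mk_surjective s
    rw [← map_add, ← map_pow, hadd, map_add, map_pow, map_pow]
  have hnil (a : A ⧸ W) (ha : ∀ r : R ⧸ P₀, D (r • a) = 0) : a = 0 := by
    obtain ⟨a, rfl⟩ := W.mkQ_surjective a
    have h1 (r : R) : C (r • a) ∈ W := by
      have := ha (Ideal.Quotient.mk P₀ r)
      rw [hmk, hD] at this
      exact (Submodule.Quotient.mk_eq_zero W).mp this
    have h2 (b : A) (hb : b ∈ W ⊔ Submodule.span R {a}) : C b ∈ W := by
      obtain ⟨w, hw, c, hc, rfl⟩ := Submodule.mem_sup.mp hb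
      obtain ⟨r, rfl⟩ := Submodule.mem_span_singleton.mp hc
      rw [map_add]
      exact add_mem (hW w hw) (h1 r)
    have h3 : W ⊔ Submodule.span R {a} ∈ 𝒲 := by
      refine ⟨hNW.trans le_sup_left, fun b hb => Submodule.mem_sup_left (h2 b hb), e + 1,
        fun b hb => ?_⟩
      rw [Function.iterate_succ_apply]
      exact he _ (h2 b hb)
    refine (Submodule.Quotient.mk_eq_zero W).mpr ?_
    by_contra haW
    refine hmax _ h3 (lt_of_le_of_ne le_sup_left fun heq => haW ?_)
    rw [heq]
    exact Submodule.mem_sup_right (Submodule.mem_span_singleton_self a)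
  obtain ⟨f, hf, H⟩ := exists_generic_smul_mem (hR.quotient P₀) hq hadd' hDlin hnil
  obtain ⟨f, rfl⟩ := Ideal.Quotient.mk_surjective f
  refine ⟨f, fun h => hf (Ideal.Quotient.eq_zero_iff_mem.mpr h), ?_⟩
  intro P hP hle hfP B hB hPB
  have hNB : N₀ ≤ B := sInf_le ⟨hB, fun r hr => (hPB r).mp (hle hr)⟩
  by_contra hne
  let B' : Submodule (R ⧸ P₀) (A ⧸ W) :=
    { carrier := {x | ∃ b ∈ W ⊔ B, W.mkQ b = x}
      add_mem' := by
        rintro _ _ ⟨b, hb, rfl⟩ ⟨c, hc, rfl⟩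
        exact ⟨b + c, add_mem hb hc, map_add _ _ _⟩
      zero_mem' := ⟨0, zero_mem _, map_zero _⟩
      smul_mem' := by
        rintro r _ ⟨b, hb, rfl⟩
        obtain ⟨r, rfl⟩ := Ideal.Quotient.mk_surjective r
        exact ⟨r • b, Submodule.smul_mem _ r hb, rfl⟩ }
  -- If `P ≠ P₀`, the generic statement gives `s ∉ P` with `s • A ⊆ W ⊔ B`.
  obtain ⟨s, hs, hsB⟩ := H (P.map (Ideal.Quotient.mk P₀))
    (Ideal.map_isPrime_of_surjective Ideal.Quotient.mk_surjective (by rwa [Ideal.mk_ker]))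
    (fun h => hne (le_antisymm (by rwa [Ideal.map_eq_bot_iff_le_ker, Ideal.mk_ker] at h) hle))
    (fun h => hfP ((Ideal.mem_quotient_iff_mem hle).mp h)) B'
    (by
      rintro _ ⟨b, hb, rfl⟩
      obtain ⟨w, hw, c, hc, rfl⟩ := Submodule.mem_sup.mp hb
      refine ⟨C (w + c), ?_, rfl⟩
      rw [map_add]
      exact add_mem (Submodule.mem_sup_left (hW w hw)) (Submodule.mem_sup_right (hB c hc)))
    (by
      intro r hr a
      obtain ⟨r, rfl⟩ := Ideal.Quotient.mk_surjective r
      obtain ⟨a, rfl⟩ := W.mkQ_surjective a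
      exact ⟨r • a, Submodule.mem_sup_right
        ((hPB r).mp ((Ideal.mem_quotient_iff_mem hle).mp hr) a), rfl⟩)
  obtain ⟨s, rfl⟩ := Ideal.Quotient.mk_surjective s
  refine hs (Ideal.mem_map_of_mem _ ((hPB s).mpr fun a => ?_))
  have h1 (a : A) : s • a ∈ W ⊔ B := by
    obtain ⟨b, hb, h⟩ := hsB (W.mkQ a)
    rw [hmk] at h
    have h2 := (Submodule.Quotient.eq W).mp h
    rw [← sub_sub_cancel b (s • a)]
    exact sub_mem hb (Submodule.mem_sup_left h2)
  -- Surjectivity removes `W`: `s • C ^ e a = C ^ e (s ^ q ^ e • a)` lies in `C ^ e (W ⊔ B) ⊆ N₀ ⊔ B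
  -- = B`, so `s ∈ P`.
  obtain ⟨a, rfl⟩ := hsurj.iterate e a
  rw [← iterate_pow_smul hC, ← Nat.sub_add_cancel (Nat.one_le_pow e q (by omega)), pow_succ',
    mul_smul]
  obtain ⟨w, hw, b, hb, h⟩ := Submodule.mem_sup.mp (h1 (s ^ (q ^ e - 1) • a))
  rw [← h, iterate_map_add]
  exact add_mem (hNB (he w hw)) (iterate_mem_of_stable hB e hb)

/-- The set of annihilators of quotients by stable submodules is finite, if `C` is surjective. -/
theorem finite_annihilators_of_surjective (hR : IsFrobeniusFinite q R) (hq : 2 ≤ q)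
    (hadd : ∀ r s : R, (r + s) ^ q = r ^ q + s ^ q)
    (hC : ∀ (r : R) (a : A), C (r ^ q • a) = r • C a) (hsurj : Function.Surjective C) :
    {I : Ideal R | ∃ B : Submodule R A, (∀ a ∈ B, C a ∈ B) ∧
      ∀ r, r ∈ I ↔ ∀ a, r • a ∈ B}.Finite := by
  let 𝓘 : Set (Ideal R) := {I : Ideal R | ∃ B : Submodule R A, (∀ a ∈ B, C a ∈ B) ∧
      ∀ r, r ∈ I ↔ ∀ a, r • a ∈ B}
  let T : Set (Ideal R) := {P ∈ 𝓘 | P.IsPrime}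
  have hT : T.Finite := by
    refine finite_of_forall_exists_notMem (fun P hP => hP.2) fun P₀ hP₀ => ?_
    obtain ⟨f, hf, H⟩ := exists_notMem_forall_eq_of_surjective hR hq hadd hC hsurj P₀
    refine ⟨f, hf, fun P hP hle hfP => ?_⟩
    obtain ⟨⟨B, hB, hPB⟩, hprime⟩ := hP
    exact H P hprime hle hfP B hB hPB
  -- A radical ideal is the infimum of its minimal primes, so it suffices that these belong to the
  -- finite set `T`.
  refine (hT.powerset.image sInf).subset ?_
  rintro I ⟨B, hB, hIB⟩
  have hpow (r : R) (h : r ^ q ∈ I) : r ∈ I := by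
    refine (hIB r).mpr fun a => ?_
    obtain ⟨a, rfl⟩ := hsurj a
    rw [← hC]
    exact hB _ ((hIB _).mp h a)
  have hrad : I.IsRadical := (Ideal.isRadical_iff_pow_one_lt q (by omega)).mpr hpow
  refine ⟨I.minimalPrimes, fun P hP => ?_, by rw [I.sInf_minimalPrimes, hrad.radical]⟩
  have hprime : P.IsPrime := hP.1.1
  -- The witness for `P` is the kernel of `A → (A / B)_P`. Its quotient has annihilator `P`, since
  -- the radical ideal `I` generates `P` locally at `P` and `A` is finitely generated.
  refine ⟨⟨{ carrier := {a | ∃ s ∉ P, s • a ∈ B}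
             add_mem' := ?_
             zero_mem' := ⟨1, hprime.one_notMem, by rw [smul_zero]; exact zero_mem _⟩
             smul_mem' := ?_ }, ?_, fun r => ⟨fun hr a => ?_, fun hr => ?_⟩⟩, hprime⟩
  · rintro a b ⟨s, hs, ha⟩ ⟨t, ht, hb⟩
    refine ⟨s * t, fun h => (hprime.mem_or_mem h).elim hs ht, ?_⟩
    rw [smul_add]
    refine add_mem ?_ ?_
    · rw [mul_comm, mul_smul]; exact B.smul_mem _ ha
    · rw [mul_smul]; exact B.smul_mem _ hb
  · rintro r a ⟨s, hs, ha⟩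
    exact ⟨s, hs, by rw [smul_comm]; exact B.smul_mem r ha⟩
  · rintro a ⟨s, hs, ha⟩
    refine ⟨s, hs, ?_⟩
    rw [← hC, ← Nat.sub_add_cancel (show 1 ≤ q by omega), pow_succ, mul_smul]
    exact hB _ (B.smul_mem _ ha)
  · obtain ⟨y, hy, n, h⟩ := exists_mul_pow_mem_of_mem_minimalPrimes hP hr
    refine ⟨y, hy, ?_⟩
    have h1 : y * r ∈ I := by
      refine hrad ⟨n + 1, ?_⟩
      rw [mul_pow, pow_succ y, mul_assoc, pow_succ r, ← mul_assoc y]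
      exact I.mul_mem_left _ (I.mul_mem_right _ h)
    rw [← mul_smul]
    exact (hIB _).mp h1 a
  · obtain ⟨s, hs, h⟩ := exists_smul_mem_of_fg P.primeCompl (N := (⊤ : Submodule R A))
      Module.Finite.fg_top (B.comap (LinearMap.lsmul R A r)) fun a _ => by
        obtain ⟨s, hs, h⟩ := hr a
        exact ⟨s, hs, by rw [Submodule.mem_comap, map_smul]; exact h⟩
    have h1 : r * s ∈ I := (hIB _).mpr fun a => by
      rw [mul_smul]
      exact h a trivial
    exact (hprime.mem_or_mem (hP.1.2 h1)).resolve_right hs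

/-- The set of stable annihilators of the modules `C ^ e (A / B)`, where `B` is a stable submodule,
is finite. -/
theorem finite_stable_annihilators (hR : IsFrobeniusFinite q R) (hq : 2 ≤ q)
    (hadd : ∀ r s : R, (r + s) ^ q = r ^ q + s ^ q)
    (hC : ∀ (r : R) (a : A), C (r ^ q • a) = r • C a) :
    {I : Ideal R | ∃ B : Submodule R A, (∀ a ∈ B, C a ∈ B) ∧ ∃ e₀, ∀ e ≥ e₀,
      ∀ r, r ∈ I ↔ ∀ a, r • C^[e] a ∈ B}.Finite := by
  obtain ⟨e₁, he₁⟩ := exists_iterRange_eq hq hC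
  have hmaps (a : A) (ha : a ∈ iterRange hC e₁) : C a ∈ iterRange hC e₁ := by
    obtain ⟨b, rfl⟩ := ha
    exact ⟨C b, (Function.iterate_succ_apply _ _ _).symm.trans (Function.iterate_succ_apply' _ _ _)⟩
  let D : iterRange hC e₁ →+ iterRange hC e₁ :=
    { toFun a := ⟨C a.1, hmaps a.1 a.2⟩
      map_zero' := Subtype.ext (map_zero C)
      map_add' a b := Subtype.ext (map_add C a.1 b.1) }
  have hDlin (r : R) (a : iterRange hC e₁) : D (r ^ q • a) = r • D a := Subtype.ext (hC r a)
  have hDsurj : Function.Surjective D := by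
    rintro ⟨a, ha⟩
    rw [← he₁ (e₁ + 1) (by omega)] at ha
    obtain ⟨b, rfl⟩ := ha
    exact ⟨⟨C^[e₁] b, b, rfl⟩, Subtype.ext (Function.iterate_succ_apply' _ _ _).symm⟩
  -- For large `e`, `C ^ e (A / B)` is the image of the stable module `C ^ e₁ (A)`, on which `C` is
  -- surjective.
  refine (finite_annihilators_of_surjective hR hq hadd hDlin hDsurj).subset ?_
  rintro I ⟨B, hB, e₀, h⟩
  refine ⟨B.comap (iterRange hC e₁).subtype, fun a ha => hB _ ha, fun r => ?_⟩
  rw [h (max e₀ e₁) (le_max_left _ _)]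
  constructor
  · rintro h ⟨a, ha⟩
    rw [← he₁ _ (le_max_right e₀ e₁)] at ha
    obtain ⟨b, rfl⟩ := ha
    exact h b
  · intro h a
    exact h ⟨_, by rw [← he₁ _ (le_max_right e₀ e₁)]; exact ⟨a, rfl⟩⟩

end Finiteness

/-! ### Sections over affine opens and localization -/

noncomputable section Sections

variable {X : Scheme.{u}}

/-- Restriction of sections of a module. -/
def res (M : X.Modules) {V U : X.Opens} (h : V ≤ U) : Γ(M, U) →+ Γ(M, V) :=
  (M.presheaf.map (homOfLE h).op).hom

/-- Restriction of functions. -/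
def ringRes {V U : X.Opens} (h : V ≤ U) : Γ(X, U) →+* Γ(X, V) :=
  (X.presheaf.map (homOfLE h).op).hom

theorem res_smul (M : X.Modules) {V U : X.Opens} (h : V ≤ U) (r : Γ(X, U)) (m : Γ(M, U)) :
    res M h (r • m) = ringRes h r • res M h m := M.map_smul (homOfLE h) r m

theorem res_res (M : X.Modules) {W V U : X.Opens} (h : V ≤ U) (h' : W ≤ V) (m : Γ(M, U)) :
    res M h' (res M h m) = res M (h'.trans h) m := by
  have h1 : (homOfLE (h'.trans h)).op = (homOfLE h).op ≫ (homOfLE h').op := rfl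
  simp only [res]
  rw [h1, M.presheaf.map_comp]
  rfl

theorem res_self (M : X.Modules) {U : X.Opens} (h : U ≤ U) (m : Γ(M, U)) : res M h m = m := by
  have h1 : (homOfLE h).op = 𝟙 (op U) := rfl
  simp only [res]
  rw [h1, M.presheaf.map_id]
  rfl

theorem ringRes_ringRes {W V U : X.Opens} (h : V ≤ U) (h' : W ≤ V) (m : Γ(X, U)) :
    ringRes h' (ringRes h m) = ringRes (h'.trans h) m := by
  have h1 : (homOfLE (h'.trans h)).op = (homOfLE h).op ≫ (homOfLE h').op := rfl
  simp only [ringRes]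
  rw [h1, X.presheaf.map_comp]
  rfl

theorem ringRes_self {U : X.Opens} (h : U ≤ U) (m : Γ(X, U)) : ringRes h m = m := by
  have h1 : (homOfLE h).op = 𝟙 (op U) := rfl
  simp only [ringRes]
  rw [h1, X.presheaf.map_id]
  rfl

theorem hom_app_res {M N : X.Modules} (φ : M ⟶ N) {V U : X.Opens} (h : V ≤ U) (m : Γ(M, U)) :
    φ.app V (res M h m) = res N h (φ.app U m) :=
  NatTrans.naturality_apply φ.mapPresheaf (homOfLE h).op m

theorem CartierMap.app_res {q : ℕ} {M : X.Modules} (C : CartierMap q M) {V U : X.Opens} (h : V ≤ U)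
    (m : Γ(M, U)) : C.app V (res M h m) = res M h (C.app U m) :=
  NatTrans.naturality_apply C.hom (homOfLE h).op m

theorem CartierMap.app_pow_smul {q : ℕ} {M : X.Modules} (C : CartierMap q M) (U : X.Opens)
    (r : Γ(X, U)) (m : Γ(M, U)) : C.app U (r ^ q • m) = r • C.app U m := C.map_pow_smul U r m

theorem CartierMap.iterate_app_res {q : ℕ} {M : X.Modules} (C : CartierMap q M) {V U : X.Opens}
    (h : V ≤ U) (e : ℕ) (m : Γ(M, U)) :
    (C.app V)^[e] (res M h m) = res M h ((C.app U)^[e] m) := by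
  induction e generalizing m with
  | zero => rfl
  | succ e ih => rw [Function.iterate_succ_apply, Function.iterate_succ_apply, C.app_res, ih]

/-- Two sections which agree locally are equal. -/
theorem section_ext (M : X.Modules) {U : X.Opens} (s t : Γ(M, U))
    (h : ∀ x ∈ U, ∃ (V : X.Opens) (hV : V ≤ U), x ∈ V ∧ res M hV s = res M hV t) : s = t := by
  refine TopCat.Presheaf.section_ext ⟨_, M.isSheaf⟩ U _ _ fun x hx => ?_
  obtain ⟨V, hV, hxV, h⟩ := h x hx
  have h1 := congrArg (M.presheaf.germ V x hxV) h
  erw [TopCat.Presheaf.germ_res_apply, TopCat.Presheaf.germ_res_apply] at h1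
  exact h1

theorem isUnit_ringRes_basicOpen {U V : X.Opens} (f : Γ(X, U)) (h : V ≤ U)
    (hV : V ≤ X.basicOpen f) : IsUnit (ringRes h f) := by
  have h1 := (RingedSpace.isUnit_res_basicOpen X.toRingedSpace f).map (ringRes hV)
  have h2 := ringRes_ringRes (X.basicOpen_le f) hV f
  exact h2 ▸ h1

/-- The sections of `M` over `D(f)` are the localization of the sections over `U`. -/
structure IsLocalizingAt (M : X.Modules) (U : X.Opens) (f : Γ(X, U)) : Prop where
  exists_lift (t : Γ(M, X.basicOpen f)) : ∃ (n : ℕ) (s : Γ(M, U)),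
    res M (X.basicOpen_le f) s = ringRes (X.basicOpen_le f) f ^ n • t
  exists_smul_eq_zero (s : Γ(M, U)) (h : res M (X.basicOpen_le f) s = 0) : ∃ n : ℕ, f ^ n • s = 0

variable {U : X.Opens} (hU : IsAffineOpen U)

theorem fromSpec_image_le (V : (Spec Γ(X, U)).Opens) : hU.fromSpec ''ᵁ V ≤ U := by
  have h := hU.fromSpec.image_mono (le_top : V ≤ ⊤)
  rwa [Scheme.Hom.image_top_eq_opensRange, hU.opensRange_fromSpec] at h

theorem restrict_fromSpec_smul (M : X.Modules) (V : (Spec Γ(X, U)).Opens) (r : Γ(X, U))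
    (x : Γ(M.restrict hU.fromSpec, V)) :
    (M.restrictAppIso hU.fromSpec V).hom (r • x) =
      ringRes (fromSpec_image_le hU V) r • (M.restrictAppIso hU.fromSpec V).hom x := by
  rw [Scheme.Modules.smul_Spec_def]
  refine (Scheme.Modules.smul_restrictAppIso_hom_apply _ _ _ _ _).trans ?_
  have h : (Scheme.ΓSpecIso Γ(X, U)).inv ≫ (Spec Γ(X, U)).presheaf.map V.leTop.op ≫
      (hU.fromSpec.appIso V).inv = X.presheaf.map (homOfLE (fromSpec_image_le hU V)).op := by
    have h2 : V ≤ hU.fromSpec ⁻¹ᵁ U := by rw [hU.fromSpec_preimage_self]; exact le_top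
    rw [← Scheme.Hom.appLE_appIso_inv (f := hU.fromSpec) (U := U) (V := V) h2, Scheme.Hom.appLE,
      hU.fromSpec_app_self, Category.assoc, Category.assoc, ← Functor.map_comp_assoc]
    rfl
  exact congrArg (fun φ => φ.hom r • (M.restrictAppIso hU.fromSpec V).hom x) h

/-- `U` and `D(f)` arise below as images under `fromSpec`, only propositionally equal to them; this
form absorbs the transport. -/
theorem isLocalizingAt_iff_of_eq (M : X.Modules) (f : Γ(X, U)) {U' V' : X.Opens} (hU' : U' = U)
    (hV' : V' = X.basicOpen f) (h : V' ≤ U') (h₁ : U' ≤ U) (h₂ : V' ≤ U) :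
    IsLocalizingAt M U f ↔
      (∀ t : Γ(M, V'), ∃ (n : ℕ) (s : Γ(M, U')), res M h s = ringRes h₂ f ^ n • t) ∧
      (∀ s : Γ(M, U'), res M h s = 0 → ∃ n : ℕ, ringRes h₁ f ^ n • s = 0) := by
  subst hU' hV'
  simp only [ringRes_self]
  exact ⟨fun h => ⟨h.1, h.2⟩, fun h => ⟨h.1, h.2⟩⟩

/-- A dictionary between the localization criterion for modules on `Spec Γ(X, U)` and elementary
conditions on sections over `X`. -/
theorem isLocalizing_restrict_fromSpec_iff (M : X.Modules) :
    IsLocalizing (modulesSpecToSheaf.obj (M.restrict hU.fromSpec)) ↔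
      ∀ f : Γ(X, U), IsLocalizingAt M U f := by
  refine forall_congr' fun f => ?_
  have hle : hU.fromSpec ''ᵁ (PrimeSpectrum.basicOpen f) ≤ hU.fromSpec ''ᵁ ⊤ :=
    hU.fromSpec.image_mono le_top
  rw [isLocalizingAt_iff_of_eq M f (U' := hU.fromSpec ''ᵁ ⊤)
    (V' := hU.fromSpec ''ᵁ (PrimeSpectrum.basicOpen f))
    (by rw [Scheme.Hom.image_top_eq_opensRange, hU.opensRange_fromSpec])
    (hU.fromSpec_image_basicOpen f) hle (fromSpec_image_le hU _) (fromSpec_image_le hU _)]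
  let ρ := ((modulesSpecToSheaf.obj (M.restrict hU.fromSpec)).obj.map
    (PrimeSpectrum.basicOpen f).leTop.op).hom
  have hsmul (V : (Spec Γ(X, U)).Opens) (n : ℕ) (x : Γ(M.restrict hU.fromSpec, V)) :
      (M.restrictAppIso hU.fromSpec V).hom (f ^ n • x) =
        ringRes (fromSpec_image_le hU V) f ^ n • (M.restrictAppIso hU.fromSpec V).hom x := by
    rw [← map_pow]
    exact restrict_fromSpec_smul hU M V (f ^ n) x
  change IsLocalizedModule (Submonoid.powers f) ρ ↔ _
  constructor
  · intro h
    refine ⟨fun t => ?_, fun s hs => ?_⟩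
    · obtain ⟨⟨y, _, n, rfl⟩, hy⟩ := IsLocalizedModule.surj (Submonoid.powers f) ρ t
      exact ⟨n, y, hy.symm.trans (hsmul _ n t)⟩
    · obtain ⟨⟨_, n, rfl⟩, hn⟩ := (IsLocalizedModule.eq_zero_iff (Submonoid.powers f) ρ).mp hs
      exact ⟨n, (hsmul _ n s).symm.trans hn⟩
  · rintro ⟨h₁, h₂⟩
    refine IsLocalizedModule.Away.mk_of_addCommGroup ?_ (fun t => ?_) fun s hs => ?_
    · exact Scheme.Modules.isUnit_algebraMap_end_of_le_basicOpen f le_rfl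
    · obtain ⟨n, s, hs⟩ := h₁ t
      exact ⟨n, s, ((hsmul _ n t).trans hs.symm)⟩
    · obtain ⟨n, hn⟩ := h₂ s hs
      exact ⟨n, (hsmul _ n s).trans hn⟩

theorem isLocalizingAt_of_isQuasicoherent (hU : IsAffineOpen U) (M : X.Modules)
    [M.IsQuasicoherent] (f : Γ(X, U)) :
    IsLocalizingAt M U f := by
  refine (isLocalizing_restrict_fromSpec_iff hU M).mp ?_ f
  rw [← isIso_fromTildeΓ_iff_isLocalizing]
  infer_instance

end Sections

/-! ### Recognizing quasi-coherent modules -/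

noncomputable section Quasicoherent

open Limits Scheme.Modules

section

universe v₁ u₁ v₂ u₂

variable {D : Type u₁} [Category.{v₁} D] {J : GrothendieckTopology D} {R : Sheaf J RingCat.{u}}
  [HasSheafify J AddCommGrpCat.{u}] [J.WEqualsLocallyBijective AddCommGrpCat.{u}]
  {D' : Type u₂} [Category.{v₂} D'] {J' : GrothendieckTopology D'} {S : Sheaf J' RingCat.{u}}
  [HasSheafify J' AddCommGrpCat.{u}] [J'.WEqualsLocallyBijective AddCommGrpCat.{u}]

/-- Transport of a presentation along an equivalence of categories. -/
def presentationOfEquivalence (E : SheafOfModules.{u} R ≌ SheafOfModules.{u} S)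
    (η : E.functor.obj (SheafOfModules.unit R) ≅ SheafOfModules.unit S)
    {M : SheafOfModules.{u} R} {N : SheafOfModules.{u} S} (P : N.Presentation)
    (e : E.functor.obj M ≅ N) : M.Presentation :=
  have : PreservesColimitsOfSize.{u, u} E.inverse :=
    E.symm.toAdjunction.leftAdjoint_preservesColimits
  SheafOfModules.Presentation.ofIsIso (E.inverse.mapIso e.symm ≪≫ (E.unitIso.app M).symm).hom
    (P.map E.inverse (E.unitIso.app _ ≪≫ E.inverse.mapIso η))

/-- Transport of a presentation along an isomorphism. -/
def presentationOfIso {M N : SheafOfModules.{u} R} (P : N.Presentation) (e : N ≅ M) :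
    M.Presentation :=
  SheafOfModules.Presentation.ofIsIso e.hom P

end

variable {X : Scheme.{u}}

/-- A presentation of the restriction of `M` to an open subscheme gives a presentation of `M` on
the slice site. -/
def presentationOver {M : X.Modules} {U : X.Opens} (P : (M.restrict U.ι).Presentation) :
    (SheafOfModules.over (R := X.ringCatSheaf) M U).Presentation :=
  presentationOfEquivalence (S := (U : Scheme.{u}).ringCatSheaf) (overEquiv U) (Iso.refl _) P
    ((overFunctorEquiv U).app M)

/-- A module whose sections over affine opens are localizing is quasi-coherent. -/
theorem isQuasicoherent_of_isLocalizingAt (M : X.Modules)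
    (h : ∀ U : X.affineOpens, ∀ f : Γ(X, U), IsLocalizingAt M U f) : M.IsQuasicoherent := by
  have P (U : X.affineOpens) : (SheafOfModules.over (R := X.ringCatSheaf) M U.1).Presentation := by
    have hU : IsAffineOpen U.1 := U.2
    have h1 := (isIso_fromTildeΓ_iff_isLocalizing _).mpr
      ((isLocalizing_restrict_fromSpec_iff hU M).mpr (h U))
    -- The module is of the form `Γ^~`, presented by all elements of `Γ` and all relations among
    -- them.
    let P₁ : (M.restrict hU.fromSpec).Presentation :=
      presentationOfIso (R := (Spec Γ(X, U.1)).ringCatSheaf)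
        (presentationTilde.{u} _ .univ (by simp) _ (Submodule.span_eq _))
        (@asIso _ _ _ _ (M.restrict hU.fromSpec).fromTildeΓ h1)
    let e : (restrictFunctor hU.isoSpec.hom).obj (M.restrict hU.fromSpec) ≅ M.restrict U.1.ι :=
      ((restrictFunctorComp _ _).app M).symm ≪≫
        (restrictFunctorCongr hU.isoSpec_hom_fromSpec).app M
    exact presentationOver (presentationOfIso (R := (U.1 : Scheme.{u}).ringCatSheaf)
      (presentationRestrict hU.isoSpec.hom P₁) e)
  let D : SheafOfModules.QuasicoherentData (R := X.ringCatSheaf) M :=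
    { I := X.affineOpens
      X := fun U => U.1
      coversTop := by
        rw [Opens.coversTop_iff]
        exact iSup_affineOpens_eq_top X
      presentation := P }
  exact D.isQuasicoherent

end Quasicoherent

/-! ### Exactness on affine opens -/

noncomputable section Exactness

open Limits Scheme.Modules

/-- The isomorphism `Γ(M)^~ ≅ M`, if `M` is quasi-coherent. -/
def tildeΓIso {R : CommRingCat.{u}} (M : (Spec R).Modules) (h : IsIso M.fromTildeΓ) :
    (tilde.functor R).obj (moduleSpecΓFunctor.obj M) ≅ M :=
  @asIso _ _ _ _ M.fromTildeΓ h

theorem map_comp_tildeΓIso_hom {R : CommRingCat.{u}} {M Q : (Spec R).Modules} (ψ : M ⟶ Q)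
    (hM : IsIso M.fromTildeΓ) (hQ : IsIso Q.fromTildeΓ) :
    (tilde.functor R).map (moduleSpecΓFunctor.map ψ) ≫ (tildeΓIso Q hQ).hom =
      (tildeΓIso M hM).hom ≫ ψ :=
  fromTildeΓNatTrans.naturality ψ

/-- The functor of global sections preserves epimorphisms of quasi-coherent modules on an affine
scheme. -/
theorem surjective_app_top_of_epi {R : CommRingCat.{u}} {M Q : (Spec R).Modules} (ψ : M ⟶ Q)
    [Epi ψ] (hM : IsIso M.fromTildeΓ) (hQ : IsIso Q.fromTildeΓ) :
    Function.Surjective (ψ.app ⊤) := by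
  have h1 := map_comp_tildeΓIso_hom ψ hM hQ
  rw [← Iso.eq_comp_inv] at h1
  have h2 : Epi ((tilde.functor R).map (moduleSpecΓFunctor.map ψ)) := by
    rw [h1]
    infer_instance
  -- The functor `^~` reflects epimorphisms.
  have h3 : Epi (moduleSpecΓFunctor.map ψ) := (tilde.functor R).epi_of_epi_map h2
  have h4 := (ModuleCat.epi_iff_surjective (moduleSpecΓFunctor.map ψ)).mp h3
  exact h4

/-- The cokernel of a morphism of quasi-coherent modules on an affine scheme is quasi-coherent. -/
theorem essImage_tilde_cokernel {R : CommRingCat.{u}} {N M : (Spec R).Modules} (ψ : N ⟶ M)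
    (hN : IsIso N.fromTildeΓ) (hM : IsIso M.fromTildeΓ) :
    (tilde.functor R).essImage (cokernel ψ) := by
  let iso : cokernel ((tilde.functor R).map (moduleSpecΓFunctor.map ψ)) ≅ cokernel ψ :=
    cokernel.mapIso _ _ (tildeΓIso N hN) (tildeΓIso M hM) (map_comp_tildeΓIso_hom ψ hN hM)
  exact ⟨cokernel (moduleSpecΓFunctor.map ψ),
    ⟨PreservesCokernel.iso (tilde.functor R) (moduleSpecΓFunctor.map ψ) ≪≫ iso⟩⟩

variable {X : Scheme.{u}}

theorem isIso_fromTildeΓ_restrict {U : X.Opens} (hU : IsAffineOpen U) (M : X.Modules)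
    [M.IsQuasicoherent] : IsIso (M.restrict hU.fromSpec).fromTildeΓ := inferInstance

/-- An epimorphism of quasi-coherent modules is surjective on sections over affine opens. -/
theorem surjective_app_of_epi {M Q : X.Modules} (φ : M ⟶ Q) [Epi φ] [M.IsQuasicoherent]
    [Q.IsQuasicoherent] {U : X.Opens} (hU : IsAffineOpen U) : Function.Surjective (φ.app U) := by
  have h := surjective_app_top_of_epi ((restrictFunctor hU.fromSpec).map φ)
    (isIso_fromTildeΓ_restrict hU M) (isIso_fromTildeΓ_restrict hU Q)
  have h1 : Function.Surjective (φ.app (hU.fromSpec ''ᵁ ⊤)) := h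
  rwa [Scheme.Hom.image_top_eq_opensRange, hU.opensRange_fromSpec] at h1

/-- The cokernel of a morphism of quasi-coherent modules is quasi-coherent. -/
theorem isQuasicoherent_cokernel {N M : X.Modules} (φ : N ⟶ M) [N.IsQuasicoherent]
    [M.IsQuasicoherent] : (cokernel φ).IsQuasicoherent := by
  refine isQuasicoherent_of_isLocalizingAt _ fun U => ?_
  have hU : IsAffineOpen U.1 := U.2
  rw [← isLocalizing_restrict_fromSpec_iff hU, ← isIso_fromTildeΓ_iff_isLocalizing]
  have h1 := essImage_tilde_cokernel ((restrictFunctor hU.fromSpec).map φ)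
    (isIso_fromTildeΓ_restrict hU N) (isIso_fromTildeΓ_restrict hU M)
  rw [isIso_fromTildeΓ_iff]
  have : PreservesColimitsOfSize.{0, 0} (restrictFunctor hU.fromSpec) := inferInstance
  exact (tilde.functor _).essImage.prop_of_iso
    (PreservesCokernel.iso (restrictFunctor hU.fromSpec) φ).symm h1

theorem CartierMap.CartierSubmodule.isQuasicoherent_quotientModule {q : ℕ} {M : X.Modules}
    {C : CartierMap q M} (N : C.CartierSubmodule) [M.IsQuasicoherent] :
    N.quotientModule.IsQuasicoherent := by
  have := N.isQuasicoherent
  exact isQuasicoherent_cokernel N.ι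

theorem CartierMap.CartierSubmodule.surjective_π_app {q : ℕ} {M : X.Modules}
    {C : CartierMap q M} (N : C.CartierSubmodule) [M.IsQuasicoherent] {U : X.Opens}
    (hU : IsAffineOpen U) : Function.Surjective (N.π.app U) := by
  have := N.isQuasicoherent_quotientModule
  exact surjective_app_of_epi N.π hU

/-- On sections, the kernel of `M → M / N` is `N`. -/
theorem CartierMap.CartierSubmodule.π_app_eq_zero_iff {q : ℕ} {M : X.Modules}
    {C : CartierMap q M} (N : C.CartierSubmodule) (U : X.Opens) (m : Γ(M, U)) :
    N.π.app U m = 0 ↔ ∃ n, N.ι.app U n = m := by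
  have := N.mono
  let F : X.Modules ⥤ Ab.{u} := toPresheaf X ⋙ (evaluation _ _).obj (op U)
  have hF : F.PreservesZeroMorphisms := ⟨fun _ _ => rfl⟩
  have h1 : PreservesLimitsOfSize.{u, u} (toPresheaf X) := inferInstance
  have h2 : PreservesLimitsOfSize.{u, u} ((evaluation X.Opensᵒᵖ Ab.{u}).obj (op U)) :=
    inferInstance
  have : PreservesLimitsOfSize.{u, u} F := comp_preservesLimits _ _
  have : PreservesLimitsOfSize.{0, 0} F := preservesSmallestLimits_of_preservesLimits F
  -- A monomorphism is the kernel of its cokernel, and taking sections preserves kernels.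
  have hk : IsLimit (KernelFork.ofι N.ι N.ι_π) :=
    Abelian.monoIsKernelOfCokernel (CokernelCofork.ofπ N.π N.ι_π) (cokernelIsCokernel N.ι)
  have hlim := KernelFork.mapIsLimit _ hk F
  let S : ShortComplex Ab.{u} := ShortComplex.mk (F.map N.ι) (F.map N.π)
    (by rw [← F.map_comp, N.ι_π, F.map_zero])
  have hS : S.Exact := S.exact_of_f_is_kernel hlim
  constructor
  · exact (ShortComplex.ab_exact_iff S).mp hS m
  · rintro ⟨n, rfl⟩
    rw [← ConcreteCategory.comp_apply, ← Scheme.Modules.Hom.comp_app, N.ι_π]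
    rfl

end Exactness

/-! ### Finite generation of sections -/

noncomputable section FiniteSections

open Limits Scheme.Modules

section

universe v₁ u₁ v₂ u₂

variable {D : Type u₁} [Category.{v₁} D] {J : GrothendieckTopology D} {R : Sheaf J RingCat.{u}}
  [HasSheafify J AddCommGrpCat.{u}] [J.WEqualsLocallyBijective AddCommGrpCat.{u}]
  {D' : Type u₂} [Category.{v₂} D'] {J' : GrothendieckTopology D'} {S : Sheaf J' RingCat.{u}}
  [HasSheafify J' AddCommGrpCat.{u}] [J'.WEqualsLocallyBijective AddCommGrpCat.{u}]

/-- Transport of generating sections along a functor which preserves colimits and the unit. -/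
theorem exists_generatingSections_of_functor (F : SheafOfModules.{u} R ⥤ SheafOfModules.{u} S)
    (hF : PreservesColimitsOfSize.{u, u} F)
    (η : SheafOfModules.unit S ≅ F.obj (SheafOfModules.unit R))
    {M : SheafOfModules.{u} R} {N : SheafOfModules.{u} S} (σ : M.GeneratingSections)
    (e : F.obj M ≅ N) : ∃ τ : N.GeneratingSections, τ.I = σ.I :=
  ⟨(σ.map F η).ofEpi e.hom, rfl⟩

end

/-- The sections of a finitely generated quasi-coherent module on an affine scheme. -/
theorem finite_sections_of_generatingSections {R : CommRingCat.{u}} {N : (Spec R).Modules}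
    (hN : IsIso N.fromTildeΓ)
    (σ : SheafOfModules.GeneratingSections (R := (Spec R).ringCatSheaf) N) (hσ : Finite σ.I) :
    Module.Finite R (moduleSpecΓFunctor.obj N) := by
  let L : (Spec R).Modules := SheafOfModules.free (R := (Spec R).ringCatSheaf) σ.I
  let p : L ⟶ N := σ.π
  have : Epi p := σ.epi
  have hL : IsIso L.fromTildeΓ := isIso_fromTildeΓ_iff.mpr ⟨_, ⟨tildeFinsupp _⟩⟩
  have h := surjective_app_top_of_epi p hL hN
  let e : ModuleCat.of R (σ.I →₀ R) ≅ moduleSpecΓFunctor.obj L :=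
    tilde.toTildeΓNatIso.app _ ≪≫ moduleSpecΓFunctor.mapIso (tildeFinsupp σ.I)
  have h1 : Module.Finite R (moduleSpecΓFunctor.obj L) := Module.Finite.equiv e.toLinearEquiv
  exact Module.Finite.of_surjective (moduleSpecΓFunctor.map p).hom h

variable {X : Scheme.{u}}

/-- The generators pass from the slice site to the scheme `W` and then to `Spec Γ(X, U)`, where
global sections preserve the epimorphism from a free module. -/
theorem finite_sections_of_le {M : X.Modules} [M.IsQuasicoherent] {W U : X.Opens}
    (σ : (SheafOfModules.over (R := X.ringCatSheaf) M W).GeneratingSections) (hσ : Finite σ.I)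
    (hU : IsAffineOpen U) (hUW : U ≤ W) : Module.Finite Γ(X, U) Γ(M, U) := by
  obtain ⟨τ, hτ⟩ := exists_generatingSections_of_functor (S := (W : Scheme.{u}).ringCatSheaf)
    (overEquiv W).functor (overEquiv W).toAdjunction.leftAdjoint_preservesColimits (Iso.refl _) σ
    (N := M.restrict W.ι) ((overFunctorEquiv W).app M)
  let l : Spec Γ(X, U) ⟶ W := IsOpenImmersion.lift W.ι hU.fromSpec
    (by rw [hU.range_fromSpec, Scheme.Opens.range_ι]; exact hUW)
  have hl : l ≫ W.ι = hU.fromSpec := IsOpenImmersion.lift_fac _ _ _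
  have : IsOpenImmersion l := by
    have : IsOpenImmersion (l ≫ W.ι) := hl ▸ inferInstance
    exact IsOpenImmersion.of_comp l W.ι
  have hcolim : PreservesColimitsOfSize.{u, u} (restrictFunctor l) := inferInstance
  obtain ⟨τ', hτ'⟩ := exists_generatingSections_of_functor (R := (W : Scheme.{u}).ringCatSheaf)
    (S := (Spec Γ(X, U)).ringCatSheaf)
    (restrictFunctor l) hcolim (restrictUnitIso l).symm τ
    (N := M.restrict hU.fromSpec)
    (((restrictFunctorComp _ _).app M).symm ≪≫ (restrictFunctorCongr hl).app M)
  have h := finite_sections_of_generatingSections (isIso_fromTildeΓ_restrict hU M) τ'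
    (by rw [hτ', hτ]; exact hσ)
  have key : ∀ (V : X.Opens) (hV : V = U) (h : V ≤ U)
      (_ : ∃ g : Finset Γ(M, V), ∀ m : Γ(M, V), ∃ c : Γ(M, V) → Γ(X, U),
        m = ∑ i ∈ g, ringRes h (c i) • i), Module.Finite Γ(X, U) Γ(M, U) := by
    rintro V rfl h ⟨g, hg⟩
    refine ⟨⟨g, eq_top_iff.mpr fun m _ => ?_⟩⟩
    obtain ⟨c, hc⟩ := hg m
    rw [hc]
    refine Submodule.sum_mem _ fun i hi => ?_
    exact Submodule.smul_mem _ _ (Submodule.subset_span hi)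
  obtain ⟨g, hg⟩ := h
  refine key (hU.fromSpec ''ᵁ ⊤)
    (by rw [Scheme.Hom.image_top_eq_opensRange, hU.opensRange_fromSpec])
    (fromSpec_image_le hU _) ⟨g, fun m => ?_⟩
  let m' : moduleSpecΓFunctor.obj (M.restrict hU.fromSpec) := m
  have hm : m' ∈ Submodule.span Γ(X, U) (g : Set _) := by
    rw [hg]; trivial
  obtain ⟨c, -, hc⟩ := Submodule.mem_span_finset.mp hm
  refine ⟨c, hc.symm.trans ?_⟩
  refine Finset.sum_congr rfl fun i hi => ?_
  exact restrict_fromSpec_smul hU M ⊤ (c i) i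

theorem finite_sections_basicOpen {M : X.Modules} [M.IsQuasicoherent] {U : X.Opens}
    (hU : IsAffineOpen U) (f : Γ(X, U)) (h : Module.Finite Γ(X, U) Γ(M, U)) :
    Module.Finite Γ(X, X.basicOpen f) Γ(M, X.basicOpen f) := by
  obtain ⟨g, hg⟩ := h
  classical
  refine ⟨⟨g.image (res M (X.basicOpen_le f)), eq_top_iff.mpr fun t _ => ?_⟩⟩
  obtain ⟨n, s, hs⟩ := (isLocalizingAt_of_isQuasicoherent hU M f).exists_lift t
  have hu : IsUnit (ringRes (X.basicOpen_le f) f ^ n) :=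
    (isUnit_ringRes_basicOpen f _ le_rfl).pow n
  obtain ⟨v, hv⟩ := hu.exists_left_inv
  have ht : t = v • res M (X.basicOpen_le f) s := by rw [hs, smul_smul, hv, one_smul]
  rw [ht]
  refine Submodule.smul_mem _ _ ?_
  have hm : s ∈ Submodule.span Γ(X, U) (g : Set Γ(M, U)) := by rw [hg]; trivial
  obtain ⟨c, -, hc⟩ := Submodule.mem_span_finset.mp hm
  rw [← hc, map_sum]
  refine Submodule.sum_mem _ fun i hi => ?_
  rw [res_smul]
  exact Submodule.smul_mem _ _ (Submodule.subset_span (by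
    rw [Finset.coe_image]; exact Set.mem_image_of_mem _ hi))

/-- Lifts of generators over `D(f)`, after multiplication by powers of `f`, span a submodule that
absorbs every section up to a power of `f`. The sum over the finitely many `f` is everything, as
they generate the unit ideal. -/
theorem finite_sections_of_span {M : X.Modules} [M.IsQuasicoherent] {U : X.Opens}
    (hU : IsAffineOpen U) (s : Finset Γ(X, U)) (hs : Ideal.span (s : Set Γ(X, U)) = ⊤)
    (h : ∀ f ∈ s, Module.Finite Γ(X, X.basicOpen f) Γ(M, X.basicOpen f)) :
    Module.Finite Γ(X, U) Γ(M, U) := by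
  have key (f : Γ(X, U)) (hf : f ∈ s) : ∃ N : Submodule Γ(X, U) Γ(M, U), N.FG ∧
      ∀ m : Γ(M, U), ∃ n : ℕ, f ^ n • m ∈ N := by
    obtain ⟨g, hg⟩ := h f hf
    have hloc := isLocalizingAt_of_isQuasicoherent hU M f
    choose k l hkl using hloc.exists_lift
    classical
    refine ⟨Submodule.span _ (g.image l : Set Γ(M, U)), ⟨_, rfl⟩, fun m => ?_⟩
    have hm : res M (X.basicOpen_le f) m ∈
        Submodule.span Γ(X, X.basicOpen f) (g : Set Γ(M, X.basicOpen f)) := by rw [hg]; trivial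
    have h1 : ∀ t ∈ Submodule.span Γ(X, X.basicOpen f) (g : Set Γ(M, X.basicOpen f)),
        ∃ n : ℕ, ∃ b ∈ Submodule.span Γ(X, U) (g.image l : Set Γ(M, U)),
          res M (X.basicOpen_le f) b = ringRes (X.basicOpen_le f) f ^ n • t := by
      intro t ht
      induction ht using Submodule.span_induction with
      | mem t ht =>
        exact ⟨k t, l t, Submodule.subset_span (by
          rw [Finset.coe_image]; exact Set.mem_image_of_mem _ ht), hkl t⟩
      | zero => exact ⟨0, 0, Submodule.zero_mem _, by rw [map_zero, smul_zero]⟩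
      | add x y _ _ hx hy =>
        obtain ⟨n, b, hb, hb'⟩ := hx
        obtain ⟨n', b', hb1, hb1'⟩ := hy
        refine ⟨n + n', f ^ n' • b + f ^ n • b', Submodule.add_mem _ (Submodule.smul_mem _ _ hb)
          (Submodule.smul_mem _ _ hb1), ?_⟩
        rw [map_add, res_smul, res_smul, hb', hb1', map_pow, map_pow, smul_smul, smul_smul,
          ← pow_add, ← pow_add, add_comm n' n, smul_add]
      | smul a x _ hx =>
        obtain ⟨n, b, hb, hb'⟩ := hx
        obtain ⟨n', c, hc⟩ : ∃ (n' : ℕ) (c : Γ(X, U)),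
            ringRes (X.basicOpen_le f) c = ringRes (X.basicOpen_le f) f ^ n' * a := by
          have := hU.isLocalization_basicOpen f
          obtain ⟨⟨c, _, n', rfl⟩, hc⟩ := IsLocalization.surj (Submonoid.powers f) a
          refine ⟨n', c, ?_⟩
          rw [mul_comm, ← map_pow]
          exact hc.symm
        refine ⟨n + n', c • b, Submodule.smul_mem _ _ hb, ?_⟩
        rw [res_smul, hb', hc, smul_smul, smul_smul]
        congr 1
        ring
    obtain ⟨n, b, hb, hb'⟩ := h1 _ hm
    have h2 : res M (X.basicOpen_le f) (f ^ n • m - b) = 0 := by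
      rw [map_sub, res_smul, map_pow, hb', sub_self]
    obtain ⟨n', hn'⟩ := hloc.exists_smul_eq_zero _ h2
    refine ⟨n' + n, ?_⟩
    rw [smul_sub, sub_eq_zero, smul_smul, ← pow_add] at hn'
    rw [hn']
    exact Submodule.smul_mem _ _ hb
  choose! N hN hN' using key
  refine ⟨?_⟩
  have : (⨆ f ∈ s, N f) = ⊤ := by
    refine eq_top_iff.mpr fun m _ =>
      Submodule.mem_of_span_eq_top_of_smul_pow_mem _ (s : Set Γ(X, U)) hs m fun f => ?_
    have hf : f.1 ∈ s := f.2
    obtain ⟨n, hn⟩ := hN' f.1 hf m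
    exact ⟨n, (le_iSup₂_of_le f.1 hf le_rfl : N f.1 ≤ _) hn⟩
  rw [← this]
  exact Submodule.fg_biSup s N fun f hf => hN f hf

/-- The sections of a coherent module over an affine open are a finite module. -/
theorem finite_sections (M : X.Modules) [M.IsQuasicoherent] [M.IsFiniteType] {U : X.Opens}
    (hU : IsAffineOpen U) : Module.Finite Γ(X, U) Γ(M, U) := by
  obtain ⟨σ, hσ⟩ :=
    SheafOfModules.IsFiniteType.exists_localGeneratorsData (R := X.ringCatSheaf) M
  have hcov : IsOpenCover σ.X := (Opens.coversTop_iff _ _).mp σ.coversTop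
  -- Affine communication, starting from the affine opens inside an open on which finitely many
  -- generators exist.
  let ι := Σ i : σ.I, {V : X.affineOpens // V.1 ≤ σ.X i}
  refine of_affine_open_cover (P := fun V => Module.Finite Γ(X, V.1) Γ(M, V.1))
    (fun j : ι => j.2.1) ?_ ⟨U, hU⟩ (fun V f h => finite_sections_basicOpen V.2 f h)
    (fun V s hs h => finite_sections_of_span V.2 s hs fun f hf => h ⟨f, hf⟩) fun j => ?_
  · refine eq_top_iff.mpr fun x _ => ?_
    have hx : x ∈ ⨆ i, σ.X i := by rw [hcov.iSup_eq_top]; trivial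
    obtain ⟨i, hi⟩ := Opens.mem_iSup.mp hx
    obtain ⟨_, ⟨V, hV, rfl⟩, hxV, hVi⟩ :=
      X.isBasis_affineOpens.exists_subset_of_mem_open hi (σ.X i).2
    exact Opens.mem_iSup.mpr ⟨⟨i, ⟨V, hV⟩, hVi⟩, hxV⟩
  · have := hσ.isFiniteType j.1
    exact finite_sections_of_le (σ.generators j.1) this.finite j.2.1.2 j.2.2

theorem CartierMap.CartierSubmodule.finite_sections_quotientModule {q : ℕ} {M : X.Modules}
    {C : CartierMap q M} (N : C.CartierSubmodule) [M.IsQuasicoherent] [M.IsFiniteType]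
    {U : X.Opens} (hU : IsAffineOpen U) : Module.Finite Γ(X, U) Γ(N.quotientModule, U) := by
  have := finite_sections M hU
  let p : Γ(M, U) →ₗ[Γ(X, U)] Γ(N.quotientModule, U) :=
    { toFun := N.π.app U
      map_add' := map_add _
      map_smul' := fun r m => N.π.app_smul r m }
  exact Module.Finite.of_surjective p (N.surjective_π_app hU)

end FiniteSections

/-! ### Annihilator ideals and the crystalline support -/

noncomputable section Support

variable {X : Scheme.{u}} {q : ℕ} {Q : X.Modules}

/-- If the image of `C ^ e` on sections over an affine open is killed by `g`, then so is the image
over every smaller open. -/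
theorem CartierMap.ringRes_smul_iterate_eq_zero (D : CartierMap q Q) [Q.IsQuasicoherent]
    (hq : q ≠ 0) {U V : X.Opens} (hU : IsAffineOpen U) (h : V ≤ U) {e : ℕ} {g : Γ(X, U)}
    (hg : ∀ m : Γ(Q, U), g • (D.app U)^[e] m = 0) (m : Γ(Q, V)) :
    ringRes h g • (D.app V)^[e] m = 0 := by
  refine section_ext Q _ _ fun x hx => ?_
  obtain ⟨f, hfV, hxf⟩ := hU.exists_basicOpen_le (⟨x, hx⟩ : V) (h hx)
  refine ⟨X.basicOpen f, hfV, hxf, ?_⟩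
  obtain ⟨n, s, hs⟩ := (isLocalizingAt_of_isQuasicoherent hU Q f).exists_lift (res Q hfV m)
  rw [map_zero, res_smul, ringRes_ringRes, ← D.iterate_app_res hfV]
  set g' := ringRes (hfV.trans h) g
  set f' := ringRes (X.basicOpen_le f) f with hf'
  have hu : IsUnit (f' ^ n) := (isUnit_ringRes_basicOpen f _ le_rfl).pow n
  -- To pull `f ^ n` through `C ^ e` one needs the factor `f ^ (n * q ^ e)`; lifting to `s` supplies
  -- `f ^ n`, and the remaining power is put on `s`.
  have hle : n ≤ n * q ^ e := Nat.le_mul_of_pos_right _ (pow_pos (Nat.pos_of_ne_zero hq) _)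
  have h1 : (f' ^ n) ^ q ^ e • res Q hfV m =
      res Q (X.basicOpen_le f) (f ^ (n * q ^ e - n) • s) := by
    rw [res_smul, hs, smul_smul, map_pow, ← hf', ← pow_add, Nat.sub_add_cancel hle, ← pow_mul]
  have h2 : f' ^ n • (D.app (X.basicOpen f))^[e] (res Q hfV m) =
      res Q (X.basicOpen_le f) ((D.app U)^[e] (f ^ (n * q ^ e - n) • s)) := by
    rw [← D.iterate_app_res, ← h1, iterate_pow_smul (D.app_pow_smul _)]
  have h3 : f' ^ n • (g' • (D.app (X.basicOpen f))^[e] (res Q hfV m)) = 0 := by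
    rw [smul_comm, h2, ← res_smul, hg, map_zero]
  exact (hu.smul_eq_zero).mp h3

/-- The annihilator of the image of `C ^ e` on sections over `U`. -/
def CartierMap.iterateAnnihilator (D : CartierMap q Q) (e : ℕ) (U : X.Opens) : Ideal Γ(X, U) :=
  Module.annihilator Γ(X, U) (iterRange (D.app_pow_smul U) e)

theorem CartierMap.mem_iterateAnnihilator (D : CartierMap q Q) {e : ℕ} {U : X.Opens}
    {g : Γ(X, U)} :
    g ∈ D.iterateAnnihilator e U ↔ ∀ m : Γ(Q, U), g • (D.app U)^[e] m = 0 := by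
  refine Submodule.mem_annihilator.trans ⟨fun h m => h _ ⟨m, rfl⟩, ?_⟩
  rintro h _ ⟨m, rfl⟩
  exact h m

theorem CartierMap.iterateAnnihilator_mono (D : CartierMap q Q) (U : X.Opens) :
    Monotone fun e => D.iterateAnnihilator e U := by
  refine monotone_nat_of_le_succ fun e g hg => ?_
  rw [D.mem_iterateAnnihilator] at hg ⊢
  exact fun m => hg _

/-- Because `g • C x = C (g ^ q • x)`. Once the annihilators are stationary this makes them radical.
-/
theorem CartierMap.mem_iterateAnnihilator_succ_of_pow_mem (D : CartierMap q Q) {e : ℕ}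
    {U : X.Opens} {g : Γ(X, U)} (h : g ^ q ∈ D.iterateAnnihilator e U) :
    g ∈ D.iterateAnnihilator (e + 1) U := by
  rw [D.mem_iterateAnnihilator] at h ⊢
  intro m
  rw [Function.iterate_succ_apply', ← D.app_pow_smul, h, map_zero]

/-- The functions on `U` which do not vanish at `x`. -/
def nonvanishing (U : X.Opens) (x : X) (hx : x ∈ U) : Submonoid Γ(X, U) where
  carrier := {f | x ∈ X.basicOpen f}
  one_mem' := by
    rw [Set.mem_ofPred_eq, X.basicOpen_of_isUnit isUnit_one]
    exact hx
  mul_mem' := fun ha hb => by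
    rw [Set.mem_ofPred_eq, X.basicOpen_mul]
    exact ⟨ha, hb⟩

theorem germ_res (M : X.Modules) {V U : X.Opens} (h : V ≤ U) (x : X) (hx : x ∈ V) (m : Γ(M, U)) :
    M.presheaf.germ V x hx (res M h m) = M.presheaf.germ U x (h hx) m :=
  TopCat.Presheaf.germ_res_apply M.presheaf (homOfLE h) x hx m

theorem exists_res_eq_zero_of_germ_eq_zero (M : X.Modules) {U : X.Opens} (x : X) (hx : x ∈ U)
    (m : Γ(M, U)) (h : M.presheaf.germ U x hx m = 0) :
    ∃ (V : X.Opens) (hV : V ≤ U), x ∈ V ∧ res M hV m = 0 := by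
  obtain ⟨V, hxV, i, j, hV⟩ := TopCat.Presheaf.germ_eq M.presheaf x hx hx m 0
    (by rw [h, map_zero])
  exact ⟨V, leOfHom i, hxV, hV.trans (map_zero _)⟩

theorem CartierMap.stalkMap_germ (D : CartierMap q Q) (U : X.Opens) (x : X) (hx : x ∈ U)
    (e : ℕ) (m : Γ(Q, U)) :
    (D.stalkMap x)^[e] (Q.presheaf.germ U x hx m) = Q.presheaf.germ U x hx ((D.app U)^[e] m) := by
  induction e generalizing m with
  | zero => rfl
  | succ e ih =>
    rw [Function.iterate_succ_apply, Function.iterate_succ_apply, ← ih]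
    congr 1
    exact TopCat.Presheaf.stalkFunctor_map_germ_apply U x hx D.hom m

/-- A section of a quasi-coherent module over an affine open has vanishing germ at `x` if and only
if it is killed by a function which does not vanish at `x`. -/
theorem germ_eq_zero_iff [Q.IsQuasicoherent] {U : X.Opens} (hU : IsAffineOpen U) (x : X)
    (hx : x ∈ U) (m : Γ(Q, U)) :
    Q.presheaf.germ U x hx m = 0 ↔ ∃ f ∈ nonvanishing U x hx, f • m = 0 := by
  constructor
  · intro h
    obtain ⟨V, hV, hxV, h⟩ := exists_res_eq_zero_of_germ_eq_zero Q x hx m h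
    obtain ⟨f, hfV, hxf⟩ := hU.exists_basicOpen_le (⟨x, hxV⟩ : V) hx
    obtain ⟨n, hn⟩ := (isLocalizingAt_of_isQuasicoherent hU Q f).exists_smul_eq_zero m
      (by rw [← res_res Q hV hfV, h, map_zero])
    exact ⟨f ^ n, pow_mem (S := nonvanishing U x hx) hxf n, hn⟩
  · rintro ⟨f, hf, h⟩
    have h1 : res Q (X.basicOpen_le f) m = 0 := by
      refine (isUnit_ringRes_basicOpen f (X.basicOpen_le f) le_rfl).smul_eq_zero.mp ?_
      rw [← res_smul, h, map_zero]
    rw [← germ_res Q (X.basicOpen_le f) x hf, h1, map_zero]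

theorem isReduced_subscheme (I : X.IdealSheafData) (h : ∀ U, (I.ideal U).IsRadical) :
    IsReduced I.subscheme := by
  have : ∀ U, IsReduced (I.subschemeCover.openCover.X U) := by
    intro (U : X.affineOpens)
    have : _root_.IsReduced (Γ(X, U) ⧸ I.ideal U) :=
      (Ideal.isRadical_iff_quotient_reduced _).mp (h U)
    change IsReduced (Spec (.of (Γ(X, U) ⧸ I.ideal U)))
    infer_instance
  exact IsReduced.of_openCover _ I.subschemeCover.openCover

variable [IsLocallyNoetherian X]

/-- `C ^ e (Q(U))` is finitely generated over a Noetherian ring, so a single power of `f` clears the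
denominators that appear when an annihilator over `D(f)` is lifted. -/
theorem CartierMap.map_iterateAnnihilator (D : CartierMap q Q) [Q.IsQuasicoherent]
    (hq : q ≠ 0) {U : X.Opens} (hU : IsAffineOpen U) [Module.Finite Γ(X, U) Γ(Q, U)] (e : ℕ)
    (f : Γ(X, U)) :
    (D.iterateAnnihilator e U).map (ringRes (X.basicOpen_le f)) =
      D.iterateAnnihilator e (X.basicOpen f) := by
  have : IsNoetherianRing Γ(X, U) := IsLocallyNoetherian.component_noetherian ⟨U, hU⟩
  refine le_antisymm (Ideal.map_le_iff_le_comap.mpr fun g hg => ?_) fun g hg => ?_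
  · rw [D.mem_iterateAnnihilator] at hg
    rw [Ideal.mem_comap, D.mem_iterateAnnihilator]
    exact D.ringRes_smul_iterate_eq_zero hq hU _ hg
  · rw [D.mem_iterateAnnihilator] at hg
    have := hU.isLocalization_basicOpen f
    obtain ⟨⟨c, _, n, rfl⟩, hc⟩ := IsLocalization.surj (Submonoid.powers f) g
    replace hc : g * ringRes (X.basicOpen_le f) (f ^ n) = ringRes (X.basicOpen_le f) c := hc
    have hloc := isLocalizingAt_of_isQuasicoherent hU Q f
    obtain ⟨_, ⟨k, rfl⟩, hk⟩ := exists_smul_mem_of_fg (Submonoid.powers f)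
      (IsNoetherian.noetherian (iterRange (D.app_pow_smul U) e))
      (LinearMap.ker (LinearMap.lsmul Γ(X, U) Γ(Q, U) c)) (by
        rintro _ ⟨m, rfl⟩
        obtain ⟨k, hk⟩ := hloc.exists_smul_eq_zero (c • (D.app U)^[e] m) (by
          rw [res_smul, ← hc, mul_comm, mul_smul, ← D.iterate_app_res, hg, smul_zero])
        refine ⟨f ^ k, ⟨k, rfl⟩, ?_⟩
        rw [LinearMap.mem_ker, LinearMap.lsmul_apply, smul_comm]
        exact hk)
    have h1 : f ^ k * c ∈ D.iterateAnnihilator e U := by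
      rw [D.mem_iterateAnnihilator]
      intro m
      have h := hk _ ⟨m, rfl⟩
      rwa [LinearMap.mem_ker, LinearMap.lsmul_apply, smul_smul, mul_comm] at h
    have h2 := Ideal.mem_map_of_mem (ringRes (X.basicOpen_le f)) h1
    have hu : IsUnit (ringRes (X.basicOpen_le f) (f ^ (k + n))) := by
      rw [map_pow]
      exact (isUnit_ringRes_basicOpen f _ le_rfl).pow _
    have h3 : ringRes (X.basicOpen_le f) (f ^ k * c) =
        ringRes (X.basicOpen_le f) (f ^ (k + n)) * g := by
      rw [map_mul, ← hc, pow_add, map_mul]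
      ring
    rw [h3] at h2
    exact ((Ideal.unit_mul_mem_iff_mem _ hu).mp h2)

/-- The annihilators of the image of `C ^ e` form a quasi-coherent ideal sheaf. -/
def CartierMap.iterateAnnihilatorSheaf (D : CartierMap q Q) [Q.IsQuasicoherent]
    (hq : q ≠ 0) (hfin : ∀ U : X.affineOpens, Module.Finite Γ(X, U) Γ(Q, U)) (e : ℕ) :
    X.IdealSheafData where
  ideal U := D.iterateAnnihilator e U
  map_ideal_basicOpen U f := by
    have := hfin U
    exact D.map_iterateAnnihilator hq U.2 e f

theorem exists_finset_affineOpens (X : Scheme.{u}) [CompactSpace X] :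
    ∃ S : Finset X.affineOpens, ∀ x : X, ∃ U ∈ S, x ∈ U.1 := by
  obtain ⟨S, hS⟩ := isCompact_univ.elim_finite_subcover
    (fun U : X.affineOpens => (U.1 : Set X)) (fun U => U.1.2) fun x _ => by
      obtain ⟨_, ⟨U, hU, rfl⟩, hx, -⟩ :=
        X.isBasis_affineOpens.exists_subset_of_mem_open (Set.mem_univ x) isOpen_univ
      exact Set.mem_iUnion.mpr ⟨⟨U, hU⟩, hx⟩
  refine ⟨S, fun x => ?_⟩
  obtain ⟨U, hU, hx⟩ := Set.mem_iUnion₂.mp (hS (Set.mem_univ x))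
  exact ⟨U, hU, hx⟩

/-- The ascending chains of ideals stop on each member of a finite affine cover, and an ideal sheaf
is determined on that cover. -/
theorem CartierMap.exists_iterateAnnihilator_eq [CompactSpace X] (D : CartierMap q Q)
    [Q.IsQuasicoherent] (hq : q ≠ 0)
    (hfin : ∀ U : X.affineOpens, Module.Finite Γ(X, U) Γ(Q, U)) :
    ∃ e₀ : ℕ, ∀ e ≥ e₀, ∀ U : X.affineOpens,
      D.iterateAnnihilator e U = D.iterateAnnihilator e₀ U := by
  obtain ⟨S, hS⟩ := exists_finset_affineOpens X
  have h (U : X.affineOpens) : ∃ n, ∀ m, n ≤ m →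
      D.iterateAnnihilator n U = D.iterateAnnihilator m U := by
    have : IsNoetherianRing Γ(X, U) := IsLocallyNoetherian.component_noetherian U
    exact monotone_stabilizes_iff_noetherian.mpr this ⟨_, D.iterateAnnihilator_mono U⟩
  choose n hn using h
  have hle (U) (hU : U ∈ S) : n U ≤ S.sup n := Finset.le_sup hU
  refine ⟨S.sup n, fun e he U => ?_⟩
  have key : D.iterateAnnihilatorSheaf hq hfin e = D.iterateAnnihilatorSheaf hq hfin (S.sup n) := by
    refine Scheme.IdealSheafData.ext_of_iSup_eq_top (fun i : S => i.1) ?_ fun i => ?_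
    · refine eq_top_iff.mpr fun x _ => ?_
      obtain ⟨U, hU, hx⟩ := hS x
      exact Opens.mem_iSup.mpr ⟨⟨U, hU⟩, hx⟩
    · exact ((hn i.1 e ((hle _ i.2).trans he)).symm.trans (hn i.1 _ (hle _ i.2)))
  exact congrArg (fun I => Scheme.IdealSheafData.ideal I U) key

/-- A criterion for a point to lie in the crystalline support. -/
theorem CartierMap.notMem_crysSupport_iff (D : CartierMap q Q) [Q.IsQuasicoherent]
    (hq : q ≠ 0) {U : X.Opens} (hU : IsAffineOpen U) [Module.Finite Γ(X, U) Γ(Q, U)] {x : X}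
    (hx : x ∈ U) :
    x ∉ D.crysSupport ↔ ∃ e, ∃ f ∈ D.iterateAnnihilator e U, x ∈ X.basicOpen f := by
  have : IsNoetherianRing Γ(X, U) := IsLocallyNoetherian.component_noetherian ⟨U, hU⟩
  rw [crysSupport, Set.mem_ofPred_eq, not_not]
  refine exists_congr fun e => ⟨fun h => ?_, ?_⟩
  · obtain ⟨f, hf, h1⟩ := exists_smul_mem_of_fg (nonvanishing U x hx)
      (IsNoetherian.noetherian (iterRange (D.app_pow_smul U) e)) ⊥ (by
        rintro _ ⟨m, rfl⟩
        have h2 := h (Q.presheaf.germ U x hx m)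
        rw [D.stalkMap_germ, germ_eq_zero_iff hU] at h2
        exact h2)
    exact ⟨f, D.mem_iterateAnnihilator.mpr fun m => h1 _ ⟨m, rfl⟩, hf⟩
  · rintro ⟨f, hf, hxf⟩ a
    rw [D.mem_iterateAnnihilator] at hf
    obtain ⟨V, hxV, m, rfl⟩ := TopCat.Presheaf.exists_germ_eq Q.presheaf a
    have hW : x ∈ V ⊓ X.basicOpen f := ⟨hxV, hxf⟩
    have h := D.ringRes_smul_iterate_eq_zero hq hU
      (inf_le_right.trans (X.basicOpen_le f) : V ⊓ X.basicOpen f ≤ U) hf (res Q inf_le_left m)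
    rw [(isUnit_ringRes_basicOpen f _ inf_le_right).smul_eq_zero] at h
    have h1 := germ_res Q (inf_le_left : V ⊓ X.basicOpen f ≤ V) x hW m
    have h2 : (D.stalkMap x)^[e] (Q.presheaf.germ V x hxV m) = 0 := by
      rw [← h1, D.stalkMap_germ, h, map_zero]
    exact h2

/-- The stable annihilator of a coherent Cartier module. -/
theorem CartierMap.exists_isStableAnnihilator [CompactSpace X] (D : CartierMap q Q)
    [Q.IsQuasicoherent] (hq : 2 ≤ q)
    (hfin : ∀ U : X.affineOpens, Module.Finite Γ(X, U) Γ(Q, U)) :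
    ∃ I : X.IdealSheafData, D.IsStableAnnihilator I ∧ (∀ U, (I.ideal U).IsRadical) ∧
      (I.support : Set X) = D.crysSupport := by
  have hq0 : q ≠ 0 := by lia
  obtain ⟨e₀, he₀⟩ := D.exists_iterateAnnihilator_eq hq0 hfin
  refine ⟨D.iterateAnnihilatorSheaf hq0 hfin e₀, ⟨e₀, fun e he U f => ?_⟩, fun U => ?_, ?_⟩
  · rw [← D.mem_iterateAnnihilator, he₀ e he]
    rfl
  · refine (Ideal.isRadical_iff_pow_one_lt q (by lia)).mpr fun r hr => ?_
    have h := D.mem_iterateAnnihilator_succ_of_pow_mem hr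
    rwa [he₀ _ (Nat.le_succ _)] at h
  · ext x
    obtain ⟨_, ⟨U, hU, rfl⟩, hx, -⟩ :=
      X.isBasis_affineOpens.exists_subset_of_mem_open (Set.mem_univ x) isOpen_univ
    have := hfin ⟨U, hU⟩
    refine (Scheme.IdealSheafData.mem_support_iff_of_mem (U := ⟨U, hU⟩) hx).trans ?_
    rw [← not_iff_not, D.notMem_crysSupport_iff hq0 hU hx, Scheme.mem_zeroLocus_iff]
    push Not
    constructor
    · rintro ⟨f, hf, h⟩
      exact ⟨e₀, f, hf, h⟩
    · rintro ⟨e, f, hf, h⟩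
      refine ⟨f, ?_, h⟩
      have h1 := D.iterateAnnihilator_mono U (le_max_left e e₀) hf
      have h2 := he₀ (max e e₀) (le_max_right _ _) ⟨U, hU⟩
      exact (SetLike.ext_iff.mp h2 f).mp h1

end Support

/-! ### Finiteness of the collection of supports -/

noncomputable section FiniteSupports

section

variable {K : Type u} [Field K] [Fintype K] {X : Scheme.{u}}

theorem add_pow_card_section (s : X ⟶ Spec (CommRingCat.of K)) (U : X.Opens) (a b : Γ(X, U)) :
    (a + b) ^ Fintype.card K = a ^ Fintype.card K + b ^ Fintype.card K :=
  map_add (frobeniusApp s U) a b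

theorem isFrobeniusFinite_of_finite {R : Type*} [CommRing R] {q : ℕ} (φ : R →+* R)
    (hφ : ∀ r, φ r = r ^ q) (h : φ.Finite) : IsFrobeniusFinite q R := by
  obtain ⟨n, b, hb⟩ := @Module.Finite.exists_fin R R _ _ φ.toAlgebra.toModule h
  refine ⟨n, b, fun r => ?_⟩
  have hr : r ∈ @Submodule.span R R _ _ φ.toAlgebra.toModule (Set.range b) := by
    rw [hb]
    trivial
  obtain ⟨c, hc⟩ := (@Submodule.mem_span_range_iff_exists_fun (Fin n) R R _ _ _ φ.toAlgebra.toModule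
    b r).mp hr
  refine ⟨c, hc.symm.trans (Finset.sum_congr rfl fun i _ => ?_)⟩
  rw [← hφ]
  rfl

theorem isFrobeniusFinite_section (s : X ⟶ Spec (CommRingCat.of K)) [IsFinite (frobenius s)]
    {U : X.Opens} (hU : IsAffineOpen U) : IsFrobeniusFinite (Fintype.card K) Γ(X, U) :=
  isFrobeniusFinite_of_finite ((frobenius s).app U).hom (frobenius_app_apply s U)
    (IsFinite.finite_app (frobenius s) U hU)

end

variable {X : Scheme.{u}} {q : ℕ} {M : X.Modules}

theorem CartierMap.CartierSubmodule.iterate_quotient_app_π {C : CartierMap q M}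
    (N : C.CartierSubmodule) (U : X.Opens) (e : ℕ) (m : Γ(M, U)) :
    (N.quotient.app U)^[e] (N.π.app U m) = N.π.app U ((C.app U)^[e] m) := by
  induction e generalizing m with
  | zero => rfl
  | succ e ih =>
    rw [Function.iterate_succ_apply, Function.iterate_succ_apply, N.quotient_app_π, ih]

/-- The kernel of `M → M / N` on sections. -/
def CartierMap.CartierSubmodule.kerπ {C : CartierMap q M} (N : C.CartierSubmodule) (U : X.Opens) :
    Submodule Γ(X, U) Γ(M, U) where
  carrier := {m | N.π.app U m = 0}
  zero_mem' := map_zero _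
  add_mem' := fun {a b} ha hb => by
    rw [Set.mem_ofPred_eq] at ha hb ⊢
    rw [map_add, ha, hb, add_zero]
  smul_mem' := fun r m hm => by
    rw [Set.mem_ofPred_eq] at hm ⊢
    rw [Scheme.Modules.Hom.app_smul, hm, smul_zero]

variable [IsLocallyNoetherian X] [CompactSpace X]

theorem CartierMap.CartierSubmodule.exists_isStableAnnihilator {C : CartierMap q M}
    (N : C.CartierSubmodule) [M.IsQuasicoherent] [M.IsFiniteType] (hq : 2 ≤ q) :
    ∃ I : X.IdealSheafData, N.quotient.IsStableAnnihilator I ∧ (∀ U, (I.ideal U).IsRadical) ∧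
      (I.support : Set X) = N.quotient.crysSupport := by
  have := N.isQuasicoherent_quotientModule
  exact N.quotient.exists_isStableAnnihilator hq fun U => N.finite_sections_quotientModule U.2

/-- The collection of crystalline supports of quotients is finite. -/
theorem CartierMap.finite_quotientSupports (C : CartierMap q M) [M.IsQuasicoherent]
    [M.IsFiniteType] (hq : 2 ≤ q)
    (hF : ∀ U : X.affineOpens, IsFrobeniusFinite q Γ(X, U))
    (hadd : ∀ (U : X.affineOpens) (a b : Γ(X, U)), (a + b) ^ q = a ^ q + b ^ q) :
    C.quotientSupports.Finite := by
  obtain ⟨S, hS⟩ := exists_finset_affineOpens X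
  have hfin (U : S) := by
    have : IsNoetherianRing Γ(X, U.1) := IsLocallyNoetherian.component_noetherian U.1
    have := finite_sections M U.1.2
    exact finite_stable_annihilators (hF U.1) hq (hadd U.1) (C.app_pow_smul U.1)
  -- A support is recovered from its tuple of stable annihilators on the cover, and each entry
  -- ranges over a finite set.
  refine ((Set.Finite.pi' hfin).image fun J => {x : X | ∀ U : S, x ∈ U.1.1 →
    x ∈ X.zeroLocus (U := U.1.1) (J U : Set Γ(X, U.1))}).subset ?_
  rintro Y ⟨N, rfl⟩
  obtain ⟨I, ⟨e₀, hI⟩, -, hsupp⟩ := N.exists_isStableAnnihilator hq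
  refine ⟨fun U => I.ideal U.1, fun U => ⟨N.kerπ U.1, fun a ha => ?_, e₀, fun e he r => ?_⟩, ?_⟩
  · change N.π.app _ _ = 0
    rw [← N.quotient_app_π, show N.π.app _ a = 0 from ha, map_zero]
  · rw [hI e he]
    refine ⟨fun h a => ?_, fun h y => ?_⟩
    · change N.π.app _ _ = 0
      rw [Scheme.Modules.Hom.app_smul, ← N.iterate_quotient_app_π]
      exact h _
    · obtain ⟨a, rfl⟩ := N.surjective_π_app U.1.2 y
      rw [N.iterate_quotient_app_π, ← Scheme.Modules.Hom.app_smul]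
      exact h a
  · rw [← hsupp]
    ext x
    constructor
    · intro h
      obtain ⟨U, hU, hx⟩ := hS x
      exact (Scheme.IdealSheafData.mem_support_iff_of_mem hx).mpr (h ⟨U, hU⟩ hx)
    · exact fun h U hx => (Scheme.IdealSheafData.mem_support_iff_of_mem hx).mp h

end FiniteSupports

/-! ### Constructing Cartier submodules from sections -/

noncomputable section Subsheaf

variable {X : Scheme.{u}} {M : X.Modules}

/-- A family of submodules of the sections of `M`, compatible with restriction and local. -/
structure SubmoduleFamily (M : X.Modules) where
  /-- the submodule of the sections over `U` -/
  sections (U : X.Opens) : Submodule Γ(X, U) Γ(M, U)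
  res_mem {V U : X.Opens} (h : V ≤ U) {m : Γ(M, U)} (hm : m ∈ sections U) : res M h m ∈ sections V
  mem_of_locally {U : X.Opens} (m : Γ(M, U))
    (h : ∀ x ∈ U, ∃ (V : X.Opens) (hV : V ≤ U), x ∈ V ∧ res M hV m ∈ sections V) : m ∈ sections U

namespace SubmoduleFamily

variable (S : SubmoduleFamily M)

/-- The presheaf of modules of a family of submodules. -/
def toSubmodule : PresheafOfModules.Submodule M.val where
  obj U := S.sections U.unop
  map f _ hm := S.res_mem (leOfHom f.unop) hm

/-- Sections glue in `M`, and the locality axiom puts the glued section back into the family. -/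
theorem isSheaf_toPresheafOfModules :
    TopCat.Presheaf.IsSheaf (X := X) S.toSubmodule.toPresheafOfModules.presheaf := by
  rw [TopCat.Presheaf.isSheaf_iff_isSheaf_comp (forget Ab.{u})]
  apply TopCat.Presheaf.isSheaf_of_isSheafUniqueGluing_types
  intro ι U sf hsf
  let F : TopCat.Sheaf Ab.{u} X := ⟨M.presheaf, M.isSheaf⟩
  let sf' (i : ι) : Γ(M, U i) := (sf i).1
  obtain ⟨s, hs, -⟩ := F.existsUnique_gluing U sf' fun i j => congrArg Subtype.val (hsf i j)
  have hmem : s ∈ S.sections (iSup U) := by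
    refine S.mem_of_locally s fun x hx => ?_
    obtain ⟨i, hi⟩ := Opens.mem_iSup.mp hx
    refine ⟨U i, le_iSup U i, hi, ?_⟩
    have h1 : res M (le_iSup U i) s = sf' i := hs i
    rw [h1]
    exact (sf i).2
  refine ⟨⟨s, hmem⟩, fun i => Subtype.ext (hs i), fun t ht => Subtype.ext ?_⟩
  refine F.eq_of_locally_eq U t.1 s fun i => ?_
  exact (congrArg Subtype.val (ht i)).trans (hs i).symm

/-- The sheaf of modules of a family of submodules. -/
def toModules : X.Modules := ⟨S.toSubmodule.toPresheafOfModules, S.isSheaf_toPresheafOfModules⟩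

/-- The inclusion. -/
def ι : S.toModules ⟶ M := ⟨S.toSubmodule.ι⟩

instance : Mono S.ι := by
  have : Mono ((Scheme.Modules.toPresheafOfModules X).map S.ι) :=
    inferInstanceAs (Mono S.toSubmodule.ι)
  exact (Scheme.Modules.toPresheafOfModules X).mono_of_mono_map this

/-- A section over `D(f)` lifts in `M` up to a power of `f`, and the hypothesis moves a further
multiple of the lift into the family. The torsion condition is inherited from `M`. -/
theorem isQuasicoherent_toModules [M.IsQuasicoherent]
    (h : ∀ (U : X.Opens), IsAffineOpen U → ∀ (f : Γ(X, U)) (m : Γ(M, U)),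
      res M (X.basicOpen_le f) m ∈ S.sections (X.basicOpen f) →
        ∃ n : ℕ, f ^ n • m ∈ S.sections U) : S.toModules.IsQuasicoherent := by
  refine isQuasicoherent_of_isLocalizingAt _ fun U f => ⟨fun t => ?_, fun s hs => ?_⟩
  · let t' : Γ(M, X.basicOpen f) := S.ι.app _ t
    have ht' : t' ∈ S.sections (X.basicOpen f) := Subtype.prop (p := (· ∈ S.sections _)) t
    obtain ⟨n, s, hs⟩ := (isLocalizingAt_of_isQuasicoherent U.2 M f).exists_lift t'
    obtain ⟨n', hn'⟩ := h U.1 U.2 f s (by rw [hs]; exact Submodule.smul_mem _ _ ht')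
    refine ⟨n' + n, (⟨f ^ n' • s, hn'⟩ : S.sections U.1), Subtype.ext ?_⟩
    have h1 : res M (X.basicOpen_le f) (f ^ n' • s) =
        ringRes (X.basicOpen_le f) f ^ (n' + n) • t' := by
      rw [res_smul, hs, map_pow, smul_smul, pow_add]
    exact h1
  · have h1 : res M (X.basicOpen_le f) (S.ι.app _ s) = 0 := by
      rw [← hom_app_res, hs, map_zero]
    obtain ⟨n, hn⟩ := (isLocalizingAt_of_isQuasicoherent U.2 M f).exists_smul_eq_zero _ h1
    exact ⟨n, Subtype.ext hn⟩

/-- The Cartier submodule of a family of submodules. -/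
theorem exists_cartierSubmodule {q : ℕ} (C : CartierMap q M) [M.IsQuasicoherent]
    (h : ∀ (U : X.Opens), IsAffineOpen U → ∀ (f : Γ(X, U)) (m : Γ(M, U)),
      res M (X.basicOpen_le f) m ∈ S.sections (X.basicOpen f) →
        ∃ n : ℕ, f ^ n • m ∈ S.sections U)
    (hC : ∀ (U : X.Opens), ∀ m ∈ S.sections U, C.app U m ∈ S.sections U) :
    ∃ N : C.CartierSubmodule, ∀ U, N.kerπ U = S.sections U := by
  let N : C.CartierSubmodule :=
    { obj := S.toModules
      isQuasicoherent := S.isQuasicoherent_toModules h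
      ι := S.ι
      mono := inferInstance
      stable := fun U n =>
        ⟨(⟨_, hC U _ (Subtype.prop (p := (· ∈ S.sections U)) n)⟩ : S.sections U), rfl⟩ }
  refine ⟨N, fun U => ?_⟩
  ext m
  refine (N.π_app_eq_zero_iff U m).trans ⟨?_, fun hm => ⟨(⟨m, hm⟩ : S.sections U), rfl⟩⟩
  rintro ⟨n, rfl⟩
  exact Subtype.prop (p := (· ∈ S.sections U)) n

end SubmoduleFamily

end Subsheaf

/-! ### Unions and irreducible components -/

noncomputable section QuotientSupports

variable {X : Scheme.{u}} {q : ℕ} {M : X.Modules} {C : CartierMap q M}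

namespace CartierMap.CartierSubmodule

theorem mem_kerπ (N : C.CartierSubmodule) {U : X.Opens} {m : Γ(M, U)} :
    m ∈ N.kerπ U ↔ N.π.app U m = 0 := Iff.rfl

theorem app_mem_kerπ (N : C.CartierSubmodule) {U : X.Opens} {m : Γ(M, U)} (hm : m ∈ N.kerπ U) :
    C.app U m ∈ N.kerπ U := by
  rw [mem_kerπ] at hm ⊢
  rw [← N.quotient_app_π, hm, map_zero]

/-- The family of the kernels of `M → M / N` on sections. -/
def kerFamily (N : C.CartierSubmodule) : SubmoduleFamily M where
  sections := N.kerπ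
  res_mem h m hm := by
    rw [mem_kerπ] at hm ⊢
    rw [hom_app_res, hm, map_zero]
  mem_of_locally {U} m h := by
    rw [mem_kerπ]
    refine section_ext _ _ _ fun x hx => ?_
    obtain ⟨V, hV, hxV, h⟩ := h x hx
    refine ⟨V, hV, hxV, ?_⟩
    rw [map_zero, ← hom_app_res]
    exact h

theorem exists_pow_smul_mem_kerπ (N : C.CartierSubmodule) [M.IsQuasicoherent] {U : X.Opens}
    (hU : IsAffineOpen U) (f : Γ(X, U)) (m : Γ(M, U))
    (h : res M (X.basicOpen_le f) m ∈ N.kerπ (X.basicOpen f)) :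
    ∃ n : ℕ, f ^ n • m ∈ N.kerπ U := by
  have := N.isQuasicoherent_quotientModule
  rw [mem_kerπ, hom_app_res] at h
  obtain ⟨n, hn⟩ := (isLocalizingAt_of_isQuasicoherent hU _ f).exists_smul_eq_zero _ h
  refine ⟨n, ?_⟩
  rw [mem_kerπ, Scheme.Modules.Hom.app_smul, hn]

end CartierMap.CartierSubmodule

theorem exists_affineOpen_mem (x : X) : ∃ U : X.Opens, IsAffineOpen U ∧ x ∈ U := by
  obtain ⟨_, ⟨U, hU, rfl⟩, hx, -⟩ :=
    X.isBasis_affineOpens.exists_subset_of_mem_open (Set.mem_univ x) isOpen_univ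
  exact ⟨U, hU, hx⟩

theorem CartierMap.CartierSubmodule.smul_iterate_mem_kerπ (N : C.CartierSubmodule) {U : X.Opens}
    {e e' : ℕ} (h : e ≤ e') {f : Γ(X, U)} (hf : ∀ m, f • (C.app U)^[e] m ∈ N.kerπ U)
    (m : Γ(M, U)) : f • (C.app U)^[e'] m ∈ N.kerπ U := by
  obtain ⟨k, rfl⟩ := Nat.exists_eq_add_of_le h
  rw [Function.iterate_add_apply]
  exact hf _

/-- The sections of `M` whose images in the stalk of `M / N` at `x` generate a submodule which is
killed by `C ^ e`. -/
def CartierMap.CartierSubmodule.nilpotentFamily (N : C.CartierSubmodule) (x : X) (e : ℕ) :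
    SubmoduleFamily M where
  sections V :=
    { carrier := {m | ∀ (W : X.Opens) (h : W ≤ V) (hx : x ∈ W) (r : Γ(X, W)),
        N.quotientModule.presheaf.germ W x hx
          ((N.quotient.app W)^[e] (r • N.π.app W (res M h m))) = 0}
      zero_mem' := fun W h hx r => by
        rw [map_zero, map_zero, smul_zero, iterate_map_zero, map_zero]
      add_mem' := fun {a b} ha hb W h hx r => by
        rw [map_add, map_add, smul_add, iterate_map_add, map_add, ha W h hx r,
          hb W h hx r, add_zero]
      smul_mem' := fun c m hm W h hx r => by
        rw [res_smul, Scheme.Modules.Hom.app_smul, smul_smul]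
        exact hm W h hx _ }
  res_mem {V U} h m hm W hW hx r := by
    rw [res_res]
    exact hm W (hW.trans h) hx r
  mem_of_locally {U} m h W hW hx r := by
    obtain ⟨V, hV, hxV, hm⟩ := h x (hW hx)
    have hWV : x ∈ W ⊓ V := ⟨hx, hxV⟩
    have h1 := hm (W ⊓ V) inf_le_right hWV (ringRes inf_le_left r)
    rw [res_res, ← res_res M hW inf_le_left, hom_app_res, ← res_smul, CartierMap.iterate_app_res,
      germ_res] at h1
    exact h1

namespace CartierMap.CartierSubmodule

theorem mem_nilpotentFamily_of_notMem (N : C.CartierSubmodule) {x : X} {e : ℕ} {U : X.Opens}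
    (hx : x ∉ U) (m : Γ(M, U)) : m ∈ (N.nilpotentFamily x e).sections U :=
  fun _ hW hxW _ => (hx (hW hxW)).elim

/-- The defining condition involves only germs at `x`. -/
theorem mem_nilpotentFamily_of_res_mem (N : C.CartierSubmodule) {x : X} {e : ℕ} {U V : X.Opens}
    (h : V ≤ U) (hx : x ∈ V) (m : Γ(M, U)) (hm : res M h m ∈ (N.nilpotentFamily x e).sections V) :
    m ∈ (N.nilpotentFamily x e).sections U := by
  intro W hW hxW r
  have hWV : x ∈ W ⊓ V := ⟨hxW, hx⟩
  have h1 := hm (W ⊓ V) inf_le_right hWV (ringRes inf_le_left r)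
  rw [res_res, ← res_res M hW inf_le_left, hom_app_res, ← res_smul, CartierMap.iterate_app_res,
    germ_res] at h1
  exact h1

theorem app_mem_nilpotentFamily (N : C.CartierSubmodule) {x : X} {e : ℕ} {U : X.Opens}
    {m : Γ(M, U)} (hm : m ∈ (N.nilpotentFamily x e).sections U) :
    C.app U m ∈ (N.nilpotentFamily x e).sections U := by
  intro W hW hx r
  -- The scalar moves inside as `r ^ q`, and then `C ^ e` and `C` are interchanged.
  rw [← C.app_res, ← N.quotient_app_π, ← N.quotient.app_pow_smul, ← Function.iterate_succ_apply,
    Function.iterate_succ_apply']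
  have h := N.quotient.stalkMap_germ W x hx 1
    ((N.quotient.app W)^[e] (r ^ q • N.π.app W (res M hW m)))
  rw [hm W hW hx] at h
  exact h.symm.trans (map_zero _)

/-- Suppose that over affine opens every function vanishing at `x` acts nilpotently, locally at `x`,
on the image of `C ^ e`. Then the nilpotent part at `x` is a Cartier submodule. -/
theorem exists_kerπ_eq_nilpotentFamily [M.IsQuasicoherent] (hq : q ≠ 0)
    (N : C.CartierSubmodule) {x : X} {e : ℕ}
    (h : ∀ U : X.Opens, IsAffineOpen U → x ∈ U → ∀ f : Γ(X, U), x ∉ X.basicOpen f →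
      ∃ g : Γ(X, U), x ∈ X.basicOpen g ∧ ∃ n, g * f ^ n ∈ N.quotient.iterateAnnihilator e U) :
    ∃ N' : C.CartierSubmodule, ∀ U, N'.kerπ U = (N.nilpotentFamily x e).sections U := by
  have := N.isQuasicoherent_quotientModule
  refine (N.nilpotentFamily x e).exists_cartierSubmodule C (fun U hU f m hm => ?_)
    fun U m hm => N.app_mem_nilpotentFamily hm
  by_cases hxU : x ∈ U
  swap
  · exact ⟨0, N.mem_nilpotentFamily_of_notMem hxU _⟩
  by_cases hxf : x ∈ X.basicOpen f
  -- Here `D(f)` is a neighbourhood of `x`, so membership over `D(f)` already gives membership over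
  -- `U`.
  · exact ⟨0, Submodule.smul_mem _ _ (N.mem_nilpotentFamily_of_res_mem _ hxf m hm)⟩
  obtain ⟨g, hg, n, hgn⟩ := h U hU hxU f hxf
  rw [CartierMap.mem_iterateAnnihilator] at hgn
  -- `C ^ e` turns this power of `f` into `f ^ n`, and `g * f ^ n` kills the image of `C ^ e` with
  -- `g` a unit near `x`. So every section is absorbed.
  refine ⟨n * q ^ e, fun W hW hxW r => ?_⟩
  have hWg : x ∈ W ⊓ X.basicOpen g := ⟨hxW, hg⟩
  have h1 := N.quotient.ringRes_smul_iterate_eq_zero hq hU hW hgn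
    (r • N.π.app W (res M hW m))
  rw [map_mul, mul_smul, map_pow, ← iterate_pow_smul (N.quotient.app_pow_smul W), ← pow_mul,
    smul_comm, ← map_pow, ← Scheme.Modules.Hom.app_smul, ← res_smul] at h1
  have h2 := congrArg (res N.quotientModule (inf_le_left : W ⊓ X.basicOpen g ≤ W)) h1
  rw [res_smul, ringRes_ringRes, map_zero,
    (isUnit_ringRes_basicOpen g _ inf_le_right).smul_eq_zero] at h2
  rw [← germ_res _ (inf_le_left : W ⊓ X.basicOpen g ≤ W) x hWg, h2, map_zero]

end CartierMap.CartierSubmodule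

/-- Let `x` be a generic point of a component of the crystalline support. Over affine opens, every
function vanishing at `x` is nilpotent, locally at `x`, modulo the stable annihilator. -/
theorem exists_mul_pow_mem_of_specializes {I : X.IdealSheafData} {x : X}
    (hmax : ∀ y ∈ I.support, y ⤳ x → x ⤳ y) {U : X.Opens} (hU : IsAffineOpen U)
    (hxI : x ∈ I.support) (hx : x ∈ U) (f : Γ(X, U)) (hf : x ∉ X.basicOpen f) :
    ∃ g : Γ(X, U), x ∈ X.basicOpen g ∧ ∃ n, g * f ^ n ∈ I.ideal ⟨U, hU⟩ := by
  have hmem (p : PrimeSpectrum Γ(X, U)) (g : Γ(X, U)) :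
      hU.fromSpec p ∈ X.basicOpen g ↔ g ∉ p.asIdeal :=
    SetLike.ext_iff.mp (hU.fromSpec_preimage_basicOpen g) p
  obtain ⟨p, rfl⟩ : ∃ p : PrimeSpectrum Γ(X, U), hU.fromSpec p = x :=
    ⟨hU.primeIdealOf ⟨x, hx⟩, hU.fromSpec_primeIdealOf ⟨x, hx⟩⟩
  have hmemU (p : PrimeSpectrum Γ(X, U)) : hU.fromSpec p ∈ U :=
    hU.range_fromSpec.subset ⟨p, rfl⟩
  have hsupp (p : PrimeSpectrum Γ(X, U)) :
      hU.fromSpec p ∈ I.support ↔ I.ideal ⟨U, hU⟩ ≤ p.asIdeal := by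
    refine (Scheme.IdealSheafData.mem_support_iff_of_mem (U := ⟨U, hU⟩) (hmemU p)).trans ?_
    rw [Scheme.mem_zeroLocus_iff]
    refine forall₂_congr fun g hg => ?_
    rw [hmem, not_not]
  -- Smaller primes over the ideal are generizations of `x` in the support, which `hmax` identifies
  -- with `x`.
  have hp : p.asIdeal ∈ (I.ideal ⟨U, hU⟩).minimalPrimes := by
    refine ⟨⟨p.isPrime, (hsupp p).mp hxI⟩, fun P hP hle g hg => ?_⟩
    let p' : PrimeSpectrum Γ(X, U) := ⟨P, hP.1⟩
    have h1 : p' ⤳ p := (PrimeSpectrum.le_iff_specializes p' p).mp hle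
    have h2 := hmax _ ((hsupp p').mpr hP.2) (h1.map hU.fromSpec.continuous)
    by_contra hgP
    have h3 := h2.mem_open (X.basicOpen g).2 ((hmem p' g).mpr hgP)
    exact (hmem p g).mp h3 hg
  obtain ⟨g, hg, n, hgn⟩ := exists_mul_pow_mem_of_mem_minimalPrimes hp
    (not_not.mp (mt (hmem p f).mpr hf))
  exact ⟨g, (hmem p g).mpr hg, n, hgn⟩

/-- In a closed subset of a quasi-sober space every point is a specialization of a point which is
minimal with respect to specialization. -/
theorem exists_specializes_of_isClosed {α : Type*} [TopologicalSpace α] [QuasiSober α] {Z : Set α}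
    (hZ : IsClosed Z) {z : α} (hz : z ∈ Z) :
    ∃ x ∈ Z, x ⤳ z ∧ ∀ y ∈ Z, y ⤳ x → x ⤳ y := by
  have : QuasiSober Z := hZ.isClosedEmbedding_subtypeVal.quasiSober
  -- The point sought is the generic point of the component of `z` in `Z`.
  let T := irreducibleComponent (⟨z, hz⟩ : Z)
  obtain ⟨x, hx⟩ := QuasiSober.sober (isIrreducible_irreducibleComponent (x := (⟨z, hz⟩ : Z)))
    isClosed_irreducibleComponent
  have hind (a b : Z) : a ⤳ b ↔ (a : α) ⤳ b :=
    (Topology.IsInducing.subtypeVal.specializes_iff).symm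
  refine ⟨x, x.2, ?_, fun y hy hyx => ?_⟩
  · rw [← hind x ⟨z, hz⟩]
    exact hx.specializes mem_irreducibleComponent
  · rw [← hind x ⟨y, hy⟩]
    rw [← hind ⟨y, hy⟩ x] at hyx
    have h1 : irreducibleComponent (⟨z, hz⟩ : Z) ⊆ closure {(⟨y, hy⟩ : Z)} := by
      rw [← hx.def]
      exact closure_minimal (Set.singleton_subset_iff.mpr hyx.mem_closure) isClosed_closure
    have h2 := eq_irreducibleComponent isPreirreducible_singleton.closure h1
    apply hx.specializes
    rw [← h2]
    exact subset_closure rfl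

/-- The whole module as a Cartier submodule. -/
theorem CartierMap.exists_kerπ_eq_top (C : CartierMap q M) [M.IsQuasicoherent] :
    ∃ N : C.CartierSubmodule, ∀ U, N.kerπ U = ⊤ := by
  let S : SubmoduleFamily M :=
    { sections := fun _ => ⊤
      res_mem := fun _ _ _ => Submodule.mem_top
      mem_of_locally := fun _ _ => Submodule.mem_top }
  exact S.exists_cartierSubmodule C (fun _ _ _ _ _ => ⟨0, Submodule.mem_top⟩)
    fun _ _ _ => Submodule.mem_top

/-- The intersection of two Cartier submodules. -/
theorem CartierMap.exists_kerπ_eq_inf [M.IsQuasicoherent] (N₁ N₂ : C.CartierSubmodule) :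
    ∃ N : C.CartierSubmodule, ∀ U, N.kerπ U = N₁.kerπ U ⊓ N₂.kerπ U := by
  let S : SubmoduleFamily M :=
    { sections := fun U => N₁.kerπ U ⊓ N₂.kerπ U
      res_mem := fun h _ hm => ⟨N₁.kerFamily.res_mem h hm.1, N₂.kerFamily.res_mem h hm.2⟩
      mem_of_locally := fun {U} m h => by
        refine ⟨N₁.kerFamily.mem_of_locally m fun x hx => ?_,
          N₂.kerFamily.mem_of_locally m fun x hx => ?_⟩
        · obtain ⟨V, hV, hxV, h⟩ := h x hx
          exact ⟨V, hV, hxV, h.1⟩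
        · obtain ⟨V, hV, hxV, h⟩ := h x hx
          exact ⟨V, hV, hxV, h.2⟩ }
  refine S.exists_cartierSubmodule C (fun U hU f m hm => ?_)
    fun U m hm => ⟨N₁.app_mem_kerπ hm.1, N₂.app_mem_kerπ hm.2⟩
  obtain ⟨n₁, h₁⟩ := N₁.exists_pow_smul_mem_kerπ hU f m hm.1
  obtain ⟨n₂, h₂⟩ := N₂.exists_pow_smul_mem_kerπ hU f m hm.2
  refine ⟨n₁ + n₂, ?_, ?_⟩
  · rw [pow_add, mul_comm, mul_smul]
    exact Submodule.smul_mem _ _ h₁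
  · rw [pow_add, mul_smul]
    exact Submodule.smul_mem _ _ h₂

variable [M.IsQuasicoherent] [M.IsFiniteType] [IsLocallyNoetherian X]

/-- A criterion for a point to lie in the crystalline support of a quotient. -/
theorem CartierMap.CartierSubmodule.notMem_crysSupport_quotient_iff (N : C.CartierSubmodule)
    (hq : q ≠ 0) {U : X.Opens} (hU : IsAffineOpen U) {x : X} (hx : x ∈ U) :
    x ∉ N.quotient.crysSupport ↔
      ∃ e, ∃ f : Γ(X, U), x ∈ X.basicOpen f ∧ ∀ m, f • (C.app U)^[e] m ∈ N.kerπ U := by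
  have := N.isQuasicoherent_quotientModule
  have := N.finite_sections_quotientModule hU
  rw [N.quotient.notMem_crysSupport_iff hq hU hx]
  refine exists_congr fun e => exists_congr fun f => ?_
  rw [and_comm, N.quotient.mem_iterateAnnihilator]
  refine and_congr_right fun _ => ⟨fun h m => ?_, fun h y => ?_⟩
  · rw [mem_kerπ, Scheme.Modules.Hom.app_smul, ← N.iterate_quotient_app_π, h]
  · obtain ⟨m, rfl⟩ := N.surjective_π_app hU y
    rw [N.iterate_quotient_app_π, ← Scheme.Modules.Hom.app_smul]
    exact h m

theorem CartierMap.empty_mem_quotientSupports (C : CartierMap q M) (hq : q ≠ 0) :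
    ∅ ∈ C.quotientSupports := by
  obtain ⟨N, hN⟩ := C.exists_kerπ_eq_top
  refine ⟨N, (Set.eq_empty_iff_forall_notMem.mpr fun x => ?_).symm⟩
  obtain ⟨U, hU, hx⟩ := exists_affineOpen_mem x
  rw [N.notMem_crysSupport_quotient_iff hq hU hx]
  refine ⟨0, 1, ?_, fun m => ?_⟩
  · rwa [X.basicOpen_of_isUnit isUnit_one]
  · rw [hN]
    exact Submodule.mem_top

/-- The intersection `N₁ ∩ N₂` works: its quotient embeds in `M / N₁ ⊕ M / N₂` and maps onto both
summands, so it is nilpotent at `x` exactly when both are. -/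
theorem CartierMap.union_mem_quotientSupports (hq : q ≠ 0) {Y Z : Set X}
    (hY : Y ∈ C.quotientSupports) (hZ : Z ∈ C.quotientSupports) : Y ∪ Z ∈ C.quotientSupports := by
  obtain ⟨N₁, rfl⟩ := hY
  obtain ⟨N₂, rfl⟩ := hZ
  obtain ⟨N, hN⟩ := exists_kerπ_eq_inf N₁ N₂
  refine ⟨N, ?_⟩
  ext x
  obtain ⟨U, hU, hx⟩ := exists_affineOpen_mem x
  rw [← not_iff_not, Set.mem_union, not_or, N₁.notMem_crysSupport_quotient_iff hq hU hx,
    N₂.notMem_crysSupport_quotient_iff hq hU hx, N.notMem_crysSupport_quotient_iff hq hU hx]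
  constructor
  · rintro ⟨⟨e₁, f₁, hx₁, h₁⟩, e₂, f₂, hx₂, h₂⟩
    refine ⟨max e₁ e₂, f₁ * f₂, (nonvanishing U x hx).mul_mem hx₁ hx₂, fun m => ?_⟩
    rw [hN]
    constructor
    · rw [mul_comm, mul_smul]
      exact Submodule.smul_mem _ _ (N₁.smul_iterate_mem_kerπ (le_max_left _ _) h₁ m)
    · rw [mul_smul]
      exact Submodule.smul_mem _ _ (N₂.smul_iterate_mem_kerπ (le_max_right _ _) h₂ m)
  · rintro ⟨e, f, hxf, h⟩
    simp only [hN] at h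
    exact ⟨⟨e, f, hxf, fun m => (h m).1⟩, e, f, hxf, fun m => (h m).2⟩

namespace CartierMap.CartierSubmodule

/-- Away from the closure of `x` the family is all of `M`, so the quotient vanishes. At `x` one has
divided `(M / N)_x` by a part killed by `C ^ e`, which cannot make a non-nilpotent stalk nilpotent;
closedness of the support does the rest. -/
theorem crysSupport_eq_closure_of_kerπ_eq_nilpotentFamily [CompactSpace X] (hq : 2 ≤ q)
    (N N' : C.CartierSubmodule) {x : X} {e : ℕ}
    (hN' : ∀ U, N'.kerπ U = (N.nilpotentFamily x e).sections U) (hx : x ∈ N.quotient.crysSupport) :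
    N'.quotient.crysSupport = closure {x} := by
  have hq0 : q ≠ 0 := by lia
  refine subset_antisymm (fun y hy => ?_) ?_
  · by_contra hyx
    obtain ⟨_, ⟨U, hU, rfl⟩, hyU, hU'⟩ := X.isBasis_affineOpens.exists_subset_of_mem_open
      (Set.mem_compl hyx) isClosed_closure.isOpen_compl
    have hxU : x ∉ U := fun h => hU' h (subset_closure rfl)
    refine (N'.notMem_crysSupport_quotient_iff hq0 hU hyU).mpr ⟨0, 1, ?_, fun m => ?_⟩ hy
    · rwa [X.basicOpen_of_isUnit isUnit_one]
    · rw [hN']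
      exact N.mem_nilpotentFamily_of_notMem hxU _
  · obtain ⟨I, -, -, hI⟩ := N'.exists_isStableAnnihilator hq
    rw [← hI]
    refine closure_minimal (Set.singleton_subset_iff.mpr ?_) I.support.isClosed
    rw [hI]
    by_contra hxN
    obtain ⟨U, hU, hxU⟩ := exists_affineOpen_mem x
    rw [N'.notMem_crysSupport_quotient_iff hq0 hU hxU] at hxN
    obtain ⟨k, f, hxf, hf⟩ := hxN
    have := N.isQuasicoherent_quotientModule
    have := N.finite_sections_quotientModule hU
    have : IsNoetherianRing Γ(X, U) := IsLocallyNoetherian.component_noetherian ⟨U, hU⟩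
    refine (N.quotient.notMem_crysSupport_iff hq0 hU hxU).mpr ?_ hx
    obtain ⟨g, hg, hg'⟩ := exists_smul_mem_of_fg (nonvanishing U x hxU)
      (IsNoetherian.noetherian (iterRange (N.quotient.app_pow_smul U) (e + k))) ⊥ (by
        rintro _ ⟨y, rfl⟩
        obtain ⟨m, rfl⟩ := N.surjective_π_app hU y
        have h1 := hf m
        rw [hN'] at h1
        -- This multiplier completes `f` to `f ^ q ^ e`, which leaves `C ^ e` as `f`.
        have h2 := h1 U le_rfl hxU (f ^ (q ^ e - 1))
        rw [res_self, Scheme.Modules.Hom.app_smul, smul_smul, ← pow_succ,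
          Nat.sub_add_cancel (Nat.one_le_pow _ _ (by lia)),
          iterate_pow_smul (N.quotient.app_pow_smul U), ← N.iterate_quotient_app_π,
          ← Function.iterate_add_apply, germ_eq_zero_iff hU] at h2
        obtain ⟨g, hg, h2⟩ := h2
        refine ⟨g * f, mul_mem hg hxf, ?_⟩
        rw [mul_smul]
        exact h2)
    exact ⟨e + k, g, N.quotient.mem_iterateAnnihilator.mpr fun m => hg' _ ⟨m, rfl⟩, hg⟩

/-- The irreducible components of a crystalline support are crystalline supports. -/
theorem closure_mem_quotientSupports [CompactSpace X] (hq : 2 ≤ q) (N : C.CartierSubmodule) {x : X}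
    (hx : x ∈ N.quotient.crysSupport)
    (hmax : ∀ y ∈ N.quotient.crysSupport, y ⤳ x → x ⤳ y) :
    closure {x} ∈ C.quotientSupports := by
  obtain ⟨I, ⟨e, he⟩, -, hI⟩ := N.exists_isStableAnnihilator hq
  rw [← hI] at hx hmax
  -- The exponent `e` is one at which the annihilator is stable, so functions vanishing at the
  -- generic point `x` are nilpotent, locally at `x`, modulo the annihilator of `C ^ e`.
  obtain ⟨N', hN'⟩ := N.exists_kerπ_eq_nilpotentFamily (x := x) (e := e) (by lia)
    fun U hU hxU f hxf => by
      obtain ⟨g, hg, n, hgn⟩ := exists_mul_pow_mem_of_specializes hmax hU hx hxU f hxf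
      refine ⟨g, hg, n, ?_⟩
      rw [CartierMap.mem_iterateAnnihilator, ← he e le_rfl ⟨U, hU⟩]
      exact hgn
  rw [SetLike.mem_coe, ← SetLike.mem_coe, hI] at hx
  exact ⟨N', (N.crysSupport_eq_closure_of_kerπ_eq_nilpotentFamily hq N' hN' hx).symm⟩

end CartierMap.CartierSubmodule

/-- The members of the collection of crystalline supports are the finite unions of its irreducible
members. -/
theorem CartierMap.quotientSupports_eq [CompactSpace X] (hq : 2 ≤ q)
    (hfin : C.quotientSupports.Finite) :
    C.quotientSupports =
      {Y | ∃ T ⊆ {Z | Z ∈ C.quotientSupports ∧ IsIrreducible Z}, T.Finite ∧ Y = ⋃₀ T} := by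
  ext Y
  constructor
  · rintro ⟨N, rfl⟩
    let T : Set (Set X) := {Z | ∃ x ∈ N.quotient.crysSupport,
      (∀ y ∈ N.quotient.crysSupport, y ⤳ x → x ⤳ y) ∧ Z = closure {x}}
    have hT : T ⊆ {Z | Z ∈ C.quotientSupports ∧ IsIrreducible Z} := by
      rintro _ ⟨x, hx, hmax, rfl⟩
      exact ⟨N.closure_mem_quotientSupports hq hx hmax, isIrreducible_singleton.closure⟩
    have hclosed : IsClosed N.quotient.crysSupport := by
      obtain ⟨I, -, -, hI⟩ := N.exists_isStableAnnihilator hq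
      rw [← hI]
      exact I.support.isClosed
    -- `T` is the set of components of the support; it is finite as a part of the finite collection.
    refine ⟨T, hT, hfin.subset fun Z hZ => (hT hZ).1, subset_antisymm (fun z hz => ?_) ?_⟩
    · obtain ⟨x, hx, hxz, hmax⟩ := exists_specializes_of_isClosed hclosed hz
      exact ⟨closure {x}, ⟨x, hx, hmax, rfl⟩, hxz.mem_closure⟩
    · rintro z ⟨_, ⟨x, hx, -, rfl⟩, hz⟩
      exact closure_minimal (Set.singleton_subset_iff.mpr hx) hclosed hz
  · rintro ⟨T, hT, hTf, rfl⟩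
    have hT' : T ⊆ C.quotientSupports := fun Z hZ => (hT hZ).1
    clear hT
    induction T, hTf using Set.Finite.induction_on with
    | empty =>
      rw [Set.sUnion_empty]
      exact C.empty_mem_quotientSupports (by lia)
    | insert _ _ ih =>
      rw [Set.sUnion_insert]
      rw [Set.insert_subset_iff] at hT'
      exact union_mem_quotientSupports (by lia) hT'.1 (ih hT'.2)

end QuotientSupports

end CartierCrystal

/-! ### The main theorem -/

theorem proposition4p9 {K : Type u} [Field K] [Fintype K] {X : Scheme.{u}}
    (s : X ⟶ Spec (CommRingCat.of K)) [AlgebraicGeometry.IsSeparated s]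
    [AlgebraicGeometry.IsNoetherian X] [AlgebraicGeometry.IsFinite (frobenius s)]
    (M : X.Modules) [M.IsQuasicoherent] [M.IsFiniteType]
    (C : CartierMap (Fintype.card K) M) :
    (∀ N : C.CartierSubmodule, ∃ I : X.IdealSheafData,
      N.quotient.IsStableAnnihilator I ∧ IsReduced I.subscheme ∧
        (I.support : Set X) = N.quotient.crysSupport) ∧
    C.quotientSupports.Finite ∧
    C.quotientSupports =
      {Y | ∃ T ⊆ {Z | Z ∈ C.quotientSupports ∧ IsIrreducible Z}, T.Finite ∧ Y = ⋃₀ T} := by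
  have hq : 2 ≤ Fintype.card K := Fintype.one_lt_card
  have hfin : C.quotientSupports.Finite := C.finite_quotientSupports hq
    (fun U => isFrobeniusFinite_section s U.2) fun U => add_pow_card_section s U
  refine ⟨fun N => ?_, hfin, CartierMap.quotientSupports_eq hq hfin⟩
  obtain ⟨I, h₁, h₂, h₃⟩ := N.exists_isStableAnnihilator hq
  exact ⟨I, h₁, isReduced_subscheme I h₂, h₃⟩
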